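/- **Scalars.** For $\bar\delta\in[0,1)$ and $\beta\in\mathbb R$ let $p:=\bar\delta\,[(1-\bar\delta)^{-2}+2(1-\bar\delta)^{-1}]$, $q:=(1-\bar\delta)\beta-2\bar\delta$, $\theta:=\tfrac12\big(\sqrt{p^2+4q}-p\big)$, $\bar\Delta:=\dfrac{\theta(1-\bar\delta-\beta)-\beta}{1+2\theta}$, and $$\mathcal P(\beta):=c_0+c_1\beta+c_2\beta^2+c_3\beta^3,$$ where $c_0:=-2\bar\delta(1-\bar\delta)^2$, $c_1:=(1-\bar\delta)[(1+\bar\delta)^2-p]$, $c_2:=p-3-2\bar\delta^2+2\bar\delta$, $c_3:=1-\bar\delta$. Let $\bar\delta_{\max}$ be the smallest positive zero, as a function of $\bar\delta$, of the discriminant $18c_0c_1c_2c_3-4c_2^3c_0+c_2^2c_1^2-4c_3c_1^3-27c_3^2c_0^2$ of $\mathcal P$. **Setting.** Let $X_i\subset\mathbb R^{n_i}$ ($i=1,\dots,M$) be convex and bounded with nonempty interior, $F_i$ a $\nu_i$-self-concordant barrier of $X_i$ (with domain $\operatorname{int}X_i$), $c_i\in\mathbb R^{n_i}$, $A_i\in\mathbb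 R^{m\times n_i}$, $b\in\mathbb R^m$, and let $A:=[A_1,\dots,A_M]$ have full row rank. For $x=(x_1,\dots,x_M)$ put $F(x):=\sum_iF_i(x_i)$ and $\|u\|_x:=[u^T\nabla^2F(x)u]^{1/2}$. For $y\in\mathbb R^m$ and $t>0$ let $x^*(y,t)=(x_1^*(y,t),\dots,x_M^*(y,t))$, where $x_i^*(y,t)$ is the unique maximizer of $c_i^Tx_i+y^TA_ix_i-tF_i(x_i)$ over $\operatorname{int}X_i$. Let $\bar x(y,t)\in\mathbb R^{n_1+\dots+n_M}$ be an approximation of $x^*(y,t)$ and put $$g(y,t):=A\bar x(y,t)-b,\qquad H(y,t):=\tfrac1tA\,\nabla^2F(\bar x(y,t))^{-1}A^T,$$ $$\bar\lambda(y,t):=\Big[\big(\tfrac1tg(y,t)\big)^T\big(\tfrac1tH(y,t)\big)^{-1}\big(\tfrac1tg(y,t)\big)\Big]^{1/2}.$$ **Theorem.** (i) $|\bar\delta_{\max}-0.0432863855|\le 5\cdot10^{-11}$. (ii) If $0\le\bar\delta\le\bar\delta_{\max}$, then $\mathcal P$ has, counted with multiplicity, exactly three real roots $0\le\beta_*\le\beta^*<\beta_3$,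 and $\beta_*<\beta^*$ if $\bar\delta<\bar\delta_{\max}$. (iii) Let $0\le\bar\delta\le\bar\delta_{\max}$ and $\beta\in(\beta_*,\beta^*)$. Then $\bar\Delta>0$. Moreover, in the setting above, let $y\in\mathbb R^m$, $0<\Delta t<t$, $t_+:=t-\Delta t$, and let $y_+:=y-H(y,t_+)^{-1}g(y,t_+)$ be the inexact full Newton step. Assume $\bar x(y,t)\in\operatorname{int}X_1\times\dots\times\operatorname{int}X_M$ and put $$\delta_+:=\|\bar x(y_+,t_+)-x^*(y_+,t_+)\|_{x^*(y_+,t_+)},\quad \delta_1:=\|\bar x(y,t_+)-x^*(y,t_+)\|_{x^*(y,t_+)},\quad \Delta:=\|\bar x(y,t_+)-\bar x(y,t)\|_{\bar x(y,t)}.$$ If $\delta_+\le\bar\delta$, $\delta_1\le\bar\delta$, $\Delta\le\bar\Delta$ and $\bar\lambda(y,t)\le\beta$, then $\bar\lambda(y_+,t_+)\le\beta$. -/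

import Mathlib

namespace InexactDual

open Polynomial Matrix

noncomputable section

/-! ### The scalar quantities -/

/-- `p = δ̄ [(1 - δ̄)⁻² + 2 (1 - δ̄)⁻¹]`. -/
def p (δb : ℝ) : ℝ := δb * (((1 - δb) ^ 2)⁻¹ + 2 * (1 - δb)⁻¹)

/-- `q = (1 - δ̄) β - 2 δ̄`. -/
def q (δb β : ℝ) : ℝ := (1 - δb) * β - 2 * δb

/-- `θ = (√(p² + 4 q) - p) / 2`. -/
def θ (δb β : ℝ) : ℝ := (Real.sqrt (p δb ^ 2 + 4 * q δb β) - p δb) / 2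

/-- `Δ̄ = (θ (1 - δ̄ - β) - β) / (1 + 2 θ)`. -/
def Δbar (δb β : ℝ) : ℝ := (θ δb β * (1 - δb - β) - β) / (1 + 2 * θ δb β)

def c₀ (δb : ℝ) : ℝ := -2 * δb * (1 - δb) ^ 2
def c₁ (δb : ℝ) : ℝ := (1 - δb) * ((1 + δb) ^ 2 - p δb)
def c₂ (δb : ℝ) : ℝ := p δb - 3 - 2 * δb ^ 2 + 2 * δb
def c₃ (δb : ℝ) : ℝ := 1 - δb

/-- The cubic `𝒫(β) = c₀ + c₁ β + c₂ β² + c₃ β³`. -/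
def cubic (δb : ℝ) : ℝ[X] :=
  C (c₀ δb) + C (c₁ δb) * X + C (c₂ δb) * X ^ 2 + C (c₃ δb) * X ^ 3

/-- The discriminant of `𝒫`, as a function of `δ̄`. -/
def cubicDisc (δb : ℝ) : ℝ :=
  18 * c₀ δb * c₁ δb * c₂ δb * c₃ δb - 4 * c₂ δb ^ 3 * c₀ δb + c₂ δb ^ 2 * c₁ δb ^ 2
    - 4 * c₃ δb * c₁ δb ^ 3 - 27 * c₃ δb ^ 2 * c₀ δb ^ 2

/-- `δ̄_max`: the discriminant of `𝒫` equals `5` at `δ̄ = 0`, and `δ̄_max` is its smallest positive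
zero, so that `[0, δ̄_max]` is the range of `δ̄` on which it first stays nonnegative. -/
def δmax : ℝ := sInf {δb : ℝ | 0 < δb ∧ cubicDisc δb = 0}

/-! ### Self-concordant barriers

Vectors are coordinate functions; the norms below are the local norms, and the notions of
derivative, interior and boundedness do not depend on the norm chosen on `ι → ℝ`. -/

/-- The Hessian matrix of `f` at `x`. -/
def hess {ι : Type} [Fintype ι] [DecidableEq ι] (f : (ι → ℝ) → ℝ) (x : ι → ℝ) : Matrix ι ι ℝ :=
  Matrix.of fun j k => iteratedFDeriv ℝ 2 f x ![Pi.single j 1, Pi.single k 1]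

/-- The local norm `‖u‖_x = (uᵀ ∇²f(x) u)^{1/2}`. -/
def localNorm {ι : Type} [Fintype ι] [DecidableEq ι] (f : (ι → ℝ) → ℝ) (x u : ι → ℝ) : ℝ :=
  Real.sqrt (u ⬝ᵥ (hess f x *ᵥ u))

/-- `f` is a (standard) self-concordant function with open domain `D`: a closed convex `C³` function
with `|D³f(x)[u,u,u]| ≤ 2 (D²f(x)[u,u])^{3/2}`. Closedness (lower semicontinuity of the extension
of `f` by `+∞`) is expressed through the sublevel sets. -/
structure IsSelfConcordant {ι : Type} [Fintype ι] (D : Set (ι → ℝ)) (f : (ι → ℝ) → ℝ) : Prop where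
  isOpen : IsOpen D
  convexOn : ConvexOn ℝ D f
  contDiffOn : ContDiffOn ℝ 3 f D
  isClosed_sublevel : ∀ a : ℝ, IsClosed {x | x ∈ D ∧ f x ≤ a}
  third_le : ∀ x ∈ D, ∀ u : ι → ℝ,
    |iteratedFDeriv ℝ 3 f x (fun _ => u)| ≤
      2 * Real.sqrt (iteratedFDeriv ℝ 2 f x (fun _ => u)) ^ 3

/-- `f` is a `ν`-self-concordant barrier of the set `S`: a self-concordant function with domain
`int S` and `sup_u (2 ⟨∇f(x), u⟩ - ⟨∇²f(x) u, u⟩) ≤ ν` for all `x ∈ int S`. -/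
structure IsSelfConcordantBarrier {ι : Type} [Fintype ι] (S : Set (ι → ℝ)) (f : (ι → ℝ) → ℝ)
    (ν : ℝ) : Prop where
  selfConcordant : IsSelfConcordant (interior S) f
  barrier : ∀ x ∈ interior S, ∀ u : ι → ℝ,
    2 * fderiv ℝ f x u - iteratedFDeriv ℝ 2 f x (fun _ => u) ≤ ν

/-! ### The separable problem and its smoothed dual -/

/-- The data of `max ∑ᵢ cᵢᵀ xᵢ` subject to `∑ᵢ Aᵢ xᵢ = b` and `xᵢ ∈ Xᵢ`, with `M` blocks
`xᵢ ∈ ℝ^{nᵢ}` and a function `Fᵢ` (the barrier of `Xᵢ`, with parameter `νᵢ`). -/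
structure Problem (M : ℕ) (n : Fin M → ℕ) (m : ℕ) where
  c : ∀ i, Fin (n i) → ℝ
  A : ∀ i, Matrix (Fin m) (Fin (n i)) ℝ
  b : Fin m → ℝ
  X : ∀ i, Set (Fin (n i) → ℝ)
  F : ∀ i, (Fin (n i) → ℝ) → ℝ
  ν : Fin M → ℝ

/-- The index set of the coordinates of `x = (x₁, …, x_M)`. -/
abbrev Idx {M : ℕ} (n : Fin M → ℕ) : Type := (i : Fin M) × Fin (n i)

namespace Problem

variable {M : ℕ} {n : Fin M → ℕ} {m : ℕ}

/-- The `i`-th block `xᵢ` of `x = (x₁, …, x_M)`. -/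
def block (x : Idx n → ℝ) (i : Fin M) : Fin (n i) → ℝ := fun j => x ⟨i, j⟩

/-- `A = [A₁, …, A_M]`. -/
def bigA (P : Problem M n m) : Matrix (Fin m) (Idx n) ℝ := Matrix.of fun r k => P.A k.1 r k.2

/-- `F(x) = ∑ᵢ Fᵢ(xᵢ)`. -/
def bigF (P : Problem M n m) (x : Idx n → ℝ) : ℝ := ∑ i, P.F i (block x i)

/-- Membership in `int X = int X₁ × ⋯ × int X_M`, the domain of `F`. -/
def InDom (P : Problem M n m) (x : Idx n → ℝ) : Prop := ∀ i, block x i ∈ interior (P.X i)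

/-- The standing assumptions: each `Xᵢ` is convex and bounded with nonempty interior, `Fᵢ` is a
`νᵢ`-self-concordant barrier of `Xᵢ`, and `A` has full row rank. -/
structure Standing (P : Problem M n m) : Prop where
  convex : ∀ i, Convex ℝ (P.X i)
  bounded : ∀ i, Bornology.IsBounded (P.X i)
  interior_nonempty : ∀ i, (interior (P.X i)).Nonempty
  barrier : ∀ i, IsSelfConcordantBarrier (P.X i) (P.F i) (P.ν i)
  fullRowRank : P.bigA.rank = m

/-- The objective `cᵢᵀ xᵢ + yᵀ Aᵢ xᵢ - t Fᵢ(xᵢ)` of the `i`-th primal subproblem (up to the additive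
constant `t Fᵢ(xᵢᶜ)`, which does not change the maximizer). -/
def subObjective (P : Problem M n m) (i : Fin M) (y : Fin m → ℝ) (t : ℝ) (x : Fin (n i) → ℝ) : ℝ :=
  P.c i ⬝ᵥ x + y ⬝ᵥ (P.A i *ᵥ x) - t * P.F i x

/-- `xᵢ*(y,t)`: the maximizer over `int Xᵢ` of the `i`-th primal subproblem; under the standing
assumptions and for `t > 0` it exists and is unique. -/
def xstarBlock (P : Problem M n m) (i : Fin M) (y : Fin m → ℝ) (t : ℝ) : Fin (n i) → ℝ :=
  Classical.epsilon fun x =>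
    x ∈ interior (P.X i) ∧ IsMaxOn (P.subObjective i y t) (interior (P.X i)) x

/-- `x*(y,t) = (x₁*(y,t), …, x_M*(y,t))`. -/
def xstar (P : Problem M n m) (y : Fin m → ℝ) (t : ℝ) : Idx n → ℝ :=
  fun k => P.xstarBlock k.1 y t k.2

/-! The inexact quantities; `xb y t` plays the role of the approximate solution of the primal
subproblems at `(y,t)`. -/

/-- The error `‖x̄(y,t) - x*(y,t)‖_{x*(y,t)}`. -/
def err (P : Problem M n m) (xb : (Fin m → ℝ) → ℝ → Idx n → ℝ) (y : Fin m → ℝ) (t : ℝ) : ℝ :=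
  localNorm P.bigF (P.xstar y t) (xb y t - P.xstar y t)

/-- The inexact gradient `A x̄(y,t) - b`. -/
def inexGrad (P : Problem M n m) (xb : (Fin m → ℝ) → ℝ → Idx n → ℝ) (y : Fin m → ℝ) (t : ℝ) :
    Fin m → ℝ :=
  P.bigA *ᵥ xb y t - P.b

/-- The inexact Hessian `t⁻¹ A ∇²F(x̄(y,t))⁻¹ Aᵀ`. -/
def inexHess (P : Problem M n m) (xb : (Fin m → ℝ) → ℝ → Idx n → ℝ) (y : Fin m → ℝ) (t : ℝ) :
    Matrix (Fin m) (Fin m) ℝ :=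
  (1 / t) • (P.bigA * (hess P.bigF (xb y t))⁻¹ * P.bigAᵀ)

/-- The inexact Newton decrement `λ̄` at `(y,t)`, formed with the inexact gradient and the inexact
Hessian of the scaled function, that is, with both divided by `t`. -/
def inexDecrement (P : Problem M n m) (xb : (Fin m → ℝ) → ℝ → Idx n → ℝ) (y : Fin m → ℝ) (t : ℝ) :
    ℝ :=
  Real.sqrt (((1 / t) • P.inexGrad xb y t) ⬝ᵥ
    (((1 / t) • P.inexHess xb y t)⁻¹ *ᵥ ((1 / t) • P.inexGrad xb y t)))

/-- The inexact full Newton step `y - (inexact Hessian at (y,t))⁻¹ (inexact gradient at (y,t))`. -/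
def newtonStep (P : Problem M n m) (xb : (Fin m → ℝ) → ℝ → Idx n → ℝ) (y : Fin m → ℝ) (t : ℝ) :
    Fin m → ℝ :=
  y - (P.inexHess xb y t)⁻¹ *ᵥ P.inexGrad xb y t

end Problem

end

end InexactDual

/-! The decrement has a primal description. The factors of `t` cancel in `λ̄`, which is the least
local norm `‖z‖_x̄` over the solutions of `A z = A x̄ - b`, so every such solution bounds it from
above. The optimality condition `t ∇F(x*(y,t)) = c + Aᵀ y` turns a dual step into a change of
gradient: the Newton step at `(y,t₊)` changes `∇F(x*)` by `-∇²F(x₁) w₁`, where `x₁ = x̄(y,t₊)` and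
`w₁` is the least-norm solution at `x₁`.

Let `s₁, s₂` be the exact maximizers before and after the step, `x₂ = x̄(y₊,t₊)`, `w = -w₁`, and let
`w₀` represent `∇F(s₂) - ∇F(s₁)` in the Hessian at `s₁`. Then `x₂ - x₁ - w` is a competitor for the
new decrement, and it is the sum of the two approximation errors `x₂ - s₂` and `s₁ - x₁`, the error
`s₂ - s₁ - w₀` of linearizing the inverse gradient map, and the error `w₀ - w` of using the Hessian
at `x₁`. Self-concordance bounds each piece (`lnorm_newton_error_le`, `D2_rep_sub_le`) and carries
local norms from one point to another. With `λ = ‖w₀‖_{s₁}` and any `T ≥ λ/(1-λ)` the outcome is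
`λ̄₊ (1-δ̄) ≤ 2δ̄ + p T + T²` (`lnorm_inexact_step_le`).

The scalars close the loop. `θ` is the `T` for which the right side equals `(1-δ̄)β`, and a change
of `x̄` by at most `Δ̄` keeps the decrement at `(y,t₊)` small enough for `T = θ`. If `𝒫(β) > 0`,
then `θ > β/(1-δ̄-β)`, which is `Δ̄ > 0`; and `𝒫` is positive between its two smaller roots. The
third root lies above 2, so the discriminant decides whether the other two are real. -/

open Set Filter Topology

namespace InexactDual

/-! ### Second and third derivatives, and derivatives along lines -/

section SelfConcordant

variable {E : Type*} [NormedAddCommGroup E] [NormedSpace ℝ E]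

/-- The second derivative of `f` at `x` as a bilinear form. -/
noncomputable def D2 (f : E → ℝ) (x : E) : E →L[ℝ] E →L[ℝ] ℝ := fderiv ℝ (fderiv ℝ f) x

/-- The third derivative of `f` at `x` as a trilinear form. -/
noncomputable def D3 (f : E → ℝ) (x : E) : E →L[ℝ] E →L[ℝ] E →L[ℝ] ℝ :=
  fderiv ℝ (fderiv ℝ (fderiv ℝ f)) x

/-- The local norm of `u` at `x` defined by the second derivative. -/
noncomputable def lnorm (f : E → ℝ) (x u : E) : ℝ := Real.sqrt (D2 f x u u)

/-- `f` is self-concordant with the bounded open convex domain `D`. -/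
structure BddSelfConcordant (D : Set E) (f : E → ℝ) : Prop where
  isOpen : IsOpen D
  bounded : Bornology.IsBounded D
  convexOn : ConvexOn ℝ D f
  contDiffOn : ContDiffOn ℝ 3 f D
  isClosed_sublevel : ∀ a : ℝ, IsClosed {x | x ∈ D ∧ f x ≤ a}
  third_le : ∀ x ∈ D, ∀ u : E, |D3 f x u u u| ≤ 2 * Real.sqrt (D2 f x u u) ^ 3

theorem iteratedFDeriv_two_diag (f : E → ℝ) (x u : E) :
    iteratedFDeriv ℝ 2 f x (fun _ => u) = D2 f x u u := by
  rw [iteratedFDeriv_two_apply]; rfl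

section Smooth

variable {f : E → ℝ} {x : E}

theorem ContDiffAt.hasFDerivAt_one (h : ContDiffAt ℝ 3 f x) : HasFDerivAt f (fderiv ℝ f x) x :=
  (h.differentiableAt (by norm_num)).hasFDerivAt

theorem ContDiffAt.fderiv_two (h : ContDiffAt ℝ 3 f x) : ContDiffAt ℝ 2 (fderiv ℝ f) x :=
  h.fderiv_right (by norm_num)

theorem ContDiffAt.hasStrictFDerivAt_fderiv (h : ContDiffAt ℝ 3 f x) :
    HasStrictFDerivAt (fderiv ℝ f) (D2 f x) x :=
  (ContDiffAt.fderiv_two h).hasStrictFDerivAt (by norm_num)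

theorem ContDiffAt.hasFDerivAt_D2 (h : ContDiffAt ℝ 3 f x) : HasFDerivAt (D2 f) (D3 f x) x :=
  (((ContDiffAt.fderiv_two h).fderiv_right (m := 1) (by norm_num)).differentiableAt
    (by norm_num)).hasFDerivAt

theorem ContDiffAt.D2_symm (h : ContDiffAt ℝ 3 f x) (u v : E) : D2 f x u v = D2 f x v u := by
  have : IsSymmSndFDerivAt ℝ f x := h.isSymmSndFDerivAt (by simp; norm_num)
  exact this u v

theorem ContDiffAt.D3_symm_left (h : ContDiffAt ℝ 3 f x) (u v w : E) :
    D3 f x u v w = D3 f x v u w := by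
  have : IsSymmSndFDerivAt ℝ (fderiv ℝ f) x :=
    (ContDiffAt.fderiv_two h).isSymmSndFDerivAt (by simp)
  exact congrArg (fun l : E →L[ℝ] ℝ => l w) (this u v)

theorem ContDiffAt.hasFDerivAt_D2_apply (h : ContDiffAt ℝ 3 f x) (v w : E) :
    HasFDerivAt (fun z => D2 f z v w) (((D3 f x).flip v).flip w) x := by
  have h1 := (ContDiffAt.hasFDerivAt_D2 h).clm_apply (hasFDerivAt_const v x)
  have h2 := h1.clm_apply (hasFDerivAt_const w x)
  refine h2.congr_fderiv ?_
  ext z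
  simp

theorem ContDiffAt.D3_symm_right (h : ContDiffAt ℝ 3 f x) (u v w : E) :
    D3 f x u v w = D3 f x u w v := by
  have h1 := ContDiffAt.hasFDerivAt_D2_apply h v w
  have h2 := ContDiffAt.hasFDerivAt_D2_apply h w v
  have he : (fun z => D2 f z v w) =ᶠ[𝓝 x] fun z => D2 f z w v := by
    filter_upwards [h.eventually (by simp)] with z hz using ContDiffAt.D2_symm hz v w
  have := (h2.congr_of_eventuallyEq he).unique h1
  have := congrArg (fun l : E →L[ℝ] ℝ => l u) this
  simpa using this.symm

theorem ContDiffAt.iteratedFDeriv_three_diag (h : ContDiffAt ℝ 3 f x) (u : E) :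
    iteratedFDeriv ℝ 3 f x (fun _ => u) = D3 f x u u u := by
  rw [iteratedFDeriv_succ_apply_left]
  have hd : DifferentiableAt ℝ (iteratedFDeriv ℝ 2 f) x :=
    h.differentiableAt_iteratedFDeriv (by norm_num)
  have h1 : HasFDerivAt (fun z => iteratedFDeriv ℝ 2 f z (fun _ => u))
      ((ContinuousMultilinearMap.apply ℝ (fun _ : Fin 2 => E) ℝ (fun _ => u)).comp
        (fderiv ℝ (iteratedFDeriv ℝ 2 f) x)) x :=
    (ContinuousMultilinearMap.apply ℝ (fun _ : Fin 2 => E) ℝ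
      (fun _ => u)).hasFDerivAt.comp x hd.hasFDerivAt
  have h2 := ContDiffAt.hasFDerivAt_D2_apply h u u
  have he : (fun z => iteratedFDeriv ℝ 2 f z (fun _ => u)) = fun z => D2 f z u u := by
    funext z; exact iteratedFDeriv_two_diag f z u
  rw [he] at h1
  have := congrArg (fun l : E →L[ℝ] ℝ => l u) (h1.unique h2)
  simp only [ContinuousLinearMap.comp_apply, ContinuousMultilinearMap.apply_apply,
    ContinuousLinearMap.flip_apply] at this
  exact this

theorem ContDiffAt.hasDerivAt_line (u : E) (s : ℝ) (h : ContDiffAt ℝ 3 f (x + s • u)) :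
    HasDerivAt (fun s : ℝ => f (x + s • u)) (fderiv ℝ f (x + s • u) u) s := by
  have hl : HasDerivAt (fun s : ℝ => x + s • u) u s := by
    simpa using ((hasDerivAt_id s).smul_const u).const_add x
  exact (ContDiffAt.hasFDerivAt_one h).comp_hasDerivAt s hl

theorem ContDiffAt.hasDerivAt_line_fderiv (u v : E) (s : ℝ) (h : ContDiffAt ℝ 3 f (x + s • u)) :
    HasDerivAt (fun s : ℝ => fderiv ℝ f (x + s • u) v) (D2 f (x + s • u) u v) s := by
  have hl : HasDerivAt (fun s : ℝ => x + s • u) u s := by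
    simpa using ((hasDerivAt_id s).smul_const u).const_add x
  have := (ContDiffAt.hasStrictFDerivAt_fderiv h).hasFDerivAt.clm_apply (hasFDerivAt_const v _)
  refine (this.comp_hasDerivAt s hl).congr_deriv ?_
  simp

theorem ContDiffAt.hasDerivAt_line_D2 (u v w : E) (s : ℝ) (h : ContDiffAt ℝ 3 f (x + s • u)) :
    HasDerivAt (fun s : ℝ => D2 f (x + s • u) v w) (D3 f (x + s • u) u v w) s := by
  have hl : HasDerivAt (fun s : ℝ => x + s • u) u s := by
    simpa using ((hasDerivAt_id s).smul_const u).const_add x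
  exact (ContDiffAt.hasFDerivAt_D2_apply h v w).comp_hasDerivAt s hl

end Smooth

/-! ### Symmetric trilinear and bilinear forms -/

/-- For a unit vector `(c, s)` at angle `φ` and `r = √3`, the three cubic values are taken at `φ`,
`φ + π/3` and `φ + 2π/3`. As the form is odd, the minus sign moves the middle one to `φ + 4π/3`, so
these are the three angles whose triple is `3φ`. The contraction with the unit vector at angle `3φ`
is thus a combination of diagonal values whose nonnegative weights add up to `(c² + s²)²`. -/
theorem cubic_form_trisection (a b d e c s r : ℝ) (hr : r ^ 2 = 3) :
    (c ^ 2 + s ^ 2) ^ 2 * ((c ^ 3 - 3 * c * s ^ 2) * a + (3 * c ^ 2 * s - s ^ 3) * b) =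
      ((3 * c ^ 2 - s ^ 2) ^ 2 / 9) *
        (a * c ^ 3 + 3 * b * c ^ 2 * s + 3 * d * c * s ^ 2 + e * s ^ 3)
      - ((2 * s * (s - r * c)) ^ 2 / 9) *
        (a * (c / 2 - r / 2 * s) ^ 3 + 3 * b * (c / 2 - r / 2 * s) ^ 2 * (s / 2 + r / 2 * c)
          + 3 * d * (c / 2 - r / 2 * s) * (s / 2 + r / 2 * c) ^ 2 + e * (s / 2 + r / 2 * c) ^ 3)
      + ((2 * s * (s + r * c)) ^ 2 / 9) *
        (a * (-c / 2 - r / 2 * s) ^ 3 + 3 * b * (-c / 2 - r / 2 * s) ^ 2 * (-s / 2 + r / 2 * c)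
          + 3 * d * (-c / 2 - r / 2 * s) * (-s / 2 + r / 2 * c) ^ 2
          + e * (-s / 2 + r / 2 * c) ^ 3) := by
  have hr4 : r ^ 4 = 9 := by rw [show r ^ 4 = (r ^ 2) ^ 2 by ring, hr]; norm_num
  ring_nf
  rw [hr4, hr]
  ring

/-- Banach's inequality for a symmetric cubic form in two variables, in terms of its values at the
unit vectors. -/
theorem cubic_form_two_variables {a b d e K : ℝ}
    (h : ∀ c s : ℝ, c ^ 2 + s ^ 2 = 1 →
      |a * c ^ 3 + 3 * b * c ^ 2 * s + 3 * d * c * s ^ 2 + e * s ^ 3| ≤ K)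
    (α : ℝ) : |Real.cos α * a + Real.sin α * b| ≤ K := by
  obtain ⟨c, s, hcs, hc, hs⟩ : ∃ c s : ℝ, c ^ 2 + s ^ 2 = 1 ∧ Real.cos α = 4 * c ^ 3 - 3 * c ∧
      Real.sin α = 3 * s - 4 * s ^ 3 := by
    refine ⟨Real.cos (α / 3), Real.sin (α / 3), Real.cos_sq_add_sin_sq _, ?_, ?_⟩
    · rw [← Real.cos_three_mul]; congr 1; ring
    · rw [← Real.sin_three_mul]; congr 1; ring
  obtain ⟨r, hr⟩ : ∃ r : ℝ, r ^ 2 = 3 := ⟨Real.sqrt 3, Real.sq_sqrt (by norm_num)⟩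
  have h0 := h c s hcs
  have h1 := h (c / 2 - r / 2 * s) (s / 2 + r / 2 * c)
    (by linear_combination hcs + (s ^ 2 + c ^ 2) / 4 * hr)
  have h2 := h (-c / 2 - r / 2 * s) (-s / 2 + r / 2 * c)
    (by linear_combination hcs + (s ^ 2 + c ^ 2) / 4 * hr)
  have key := cubic_form_trisection a b d e c s r hr
  have hw : (3 * c ^ 2 - s ^ 2) ^ 2 / 9 + (2 * s * (s - r * c)) ^ 2 / 9
      + (2 * s * (s + r * c)) ^ 2 / 9 = (c ^ 2 + s ^ 2) ^ 2 := by
    linear_combination (8 * s ^ 2 * c ^ 2 / 9) * hr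
  rw [hcs] at key hw
  have hc' : Real.cos α = c ^ 3 - 3 * c * s ^ 2 := by
    rw [hc]; linear_combination (3 * c) * hcs
  have hs' : Real.sin α = 3 * c ^ 2 * s - s ^ 3 := by
    rw [hs]; linear_combination (-3 * s) * hcs
  rw [hc', hs', ← one_mul (_ + _), ← one_pow 2, key]
  have w0 : 0 ≤ (3 * c ^ 2 - s ^ 2) ^ 2 / 9 := by positivity
  have w1 : 0 ≤ (2 * s * (s - r * c)) ^ 2 / 9 := by positivity
  have w2 : 0 ≤ (2 * s * (s + r * c)) ^ 2 / 9 := by positivity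
  generalize (3 * c ^ 2 - s ^ 2) ^ 2 / 9 = W0 at *
  generalize (2 * s * (s - r * c)) ^ 2 / 9 = W1 at *
  generalize (2 * s * (s + r * c)) ^ 2 / 9 = W2 at *
  calc _ ≤ W0 * K + W1 * K + W2 * K := by
        refine (abs_add_le _ _).trans (add_le_add ((abs_sub _ _).trans (add_le_add ?_ ?_)) ?_)
        · rw [abs_mul, abs_of_nonneg w0]; gcongr
        · rw [abs_mul, abs_of_nonneg w1]; gcongr
        · rw [abs_mul, abs_of_nonneg w2]; gcongr
    _ = K := by linear_combination K * hw

/-- Banach's inequality: a symmetric trilinear form bounded on the diagonal by the cube of the norm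
of a positive definite form is bounded off the diagonal by the same constant. -/
theorem trilinear_le_of_diag {B : E →L[ℝ] E →L[ℝ] ℝ} {T : E →L[ℝ] E →L[ℝ] E →L[ℝ] ℝ}
    (hB : ∀ u v, B u v = B v u) (hpos : ∀ u, u ≠ 0 → 0 < B u u)
    (hT1 : ∀ u v w, T u v w = T v u w) (hT2 : ∀ u v w, T u v w = T u w v) {K : ℝ}
    (hd : ∀ u, |T u u u| ≤ K * Real.sqrt (B u u) ^ 3) (u v : E) :
    |T u v v| ≤ K * Real.sqrt (B u u) * B v v := by
  by_cases hu : u = 0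
  · simp [hu]
  by_cases hv : v = 0
  · simp [hv]
  have hBu := hpos u hu
  have hBv := hpos v hv
  obtain ⟨ρ, hρ, hρ2⟩ : ∃ ρ : ℝ, 0 < ρ ∧ ρ ^ 2 = B u u :=
    ⟨_, Real.sqrt_pos.2 hBu, Real.sq_sqrt hBu.le⟩
  obtain ⟨σ, hσ, hσ2⟩ : ∃ σ : ℝ, 0 < σ ∧ σ ^ 2 = B v v :=
    ⟨_, Real.sqrt_pos.2 hBv, Real.sq_sqrt hBv.le⟩
  rw [← hρ2, Real.sqrt_sq hρ.le, ← hσ2]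
  obtain ⟨v₁, hv₁⟩ : ∃ v₁ : E, v₁ = σ⁻¹ • v := ⟨_, rfl⟩
  have hvv : v = σ • v₁ := by rw [hv₁, smul_smul, mul_inv_cancel₀ hσ.ne', one_smul]
  have hB1 : B v₁ v₁ = 1 := by
    rw [hv₁]; simp only [map_smul, FunLike.coe_smul, Pi.smul_apply, smul_eq_mul, ← hσ2]
    field_simp
  -- Gram-Schmidt
  obtain ⟨m, hm⟩ : ∃ m : ℝ, m = B u v₁ := ⟨_, rfl⟩
  obtain ⟨w, hw⟩ : ∃ w : E, w = u - m • v₁ := ⟨_, rfl⟩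
  have huw : u = m • v₁ + w := by rw [hw]; abel
  have hwv : B w v₁ = 0 := by
    rw [hw]; simp [hB1, hm]
  have hvw : B v₁ w = 0 := by rw [hB, hwv]
  -- If `u` is a multiple of `v`, there is no second unit vector; `v₂ = 0` with `n = 0` serves,
  -- since only `B v₂ v₂ ≤ 1` and orthogonality are used for the bound.
  obtain ⟨n, v₂, hn, hB2, hB12, hv2⟩ : ∃ (n : ℝ) (v₂ : E), 0 ≤ n ∧ (B v₂ v₂ = 1 ∨ v₂ = 0 ∧ n = 0) ∧
      B v₁ v₂ = 0 ∧ w = n • v₂ := by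
    by_cases hw0 : w = 0
    · exact ⟨0, 0, le_rfl, Or.inr ⟨rfl, rfl⟩, by simp, by simp [hw0]⟩
    · have := hpos w hw0
      refine ⟨Real.sqrt (B w w), (Real.sqrt (B w w))⁻¹ • w, Real.sqrt_nonneg _, Or.inl ?_, ?_, ?_⟩
      · simp only [map_smul, FunLike.coe_smul, Pi.smul_apply, smul_eq_mul]
        rw [← mul_assoc, ← mul_inv, Real.mul_self_sqrt this.le, inv_mul_cancel₀ this.ne']
      · simp [hvw]
      · rw [smul_smul, mul_inv_cancel₀ (Real.sqrt_pos.2 this).ne', one_smul]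
  have hK : 0 ≤ K := by
    have := (abs_nonneg _).trans (hd v₁)
    simpa [hB1] using this
  have hB21 : B v₂ v₁ = 0 := by rw [hB, hB12]
  have hB2' : B v₂ v₂ ≤ 1 := by rcases hB2 with h | h <;> simp [h]
  have hmn : ρ ^ 2 = m ^ 2 + n ^ 2 := by
    have : B u u = m ^ 2 + n ^ 2 * B v₂ v₂ := by
      rw [huw, hv2]; simp [hB1, hB12, hB21]; ring
    rw [hρ2, this]
    rcases hB2 with h | h <;> simp [h]
  have hbound : ∀ α : ℝ, |Real.cos α * T v₁ v₁ v₁ + Real.sin α * T v₂ v₁ v₁| ≤ K := by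
    refine cubic_form_two_variables (d := T v₂ v₂ v₁) (e := T v₂ v₂ v₂) fun c s hcs => ?_
    have h1 := hd (c • v₁ + s • v₂)
    have h2 : B (c • v₁ + s • v₂) (c • v₁ + s • v₂) ≤ 1 := by
      simp [hB1, hB12, hB21]; nlinarith [sq_nonneg s]
    have h3 : Real.sqrt (B (c • v₁ + s • v₂) (c • v₁ + s • v₂)) ^ 3 ≤ 1 :=
      pow_le_one₀ (Real.sqrt_nonneg _) (Real.sqrt_le_one.2 h2)
    have h4 : T (c • v₁ + s • v₂) (c • v₁ + s • v₂) (c • v₁ + s • v₂) =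
        T v₁ v₁ v₁ * c ^ 3 + 3 * T v₂ v₁ v₁ * c ^ 2 * s + 3 * T v₂ v₂ v₁ * c * s ^ 2
          + T v₂ v₂ v₂ * s ^ 3 := by
      have e1 : T v₁ v₁ v₂ = T v₂ v₁ v₁ := by rw [hT2, hT1]
      have e2 : T v₁ v₂ v₁ = T v₂ v₁ v₁ := by rw [hT1]
      have e3 : T v₁ v₂ v₂ = T v₂ v₂ v₁ := by rw [hT1, hT2]
      have e4 : T v₂ v₁ v₂ = T v₂ v₂ v₁ := by rw [hT2]
      simp [e1, e2, e3, e4]; ring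
    rw [← h4]
    exact h1.trans (by nlinarith)
  obtain ⟨α, h1, h2⟩ : ∃ α : ℝ, m = ρ * Real.cos α ∧ n = ρ * Real.sin α := by
    refine ⟨Complex.arg ⟨m, n⟩, ?_, ?_⟩
    all_goals
      have hnorm : ‖(⟨m, n⟩ : ℂ)‖ = ρ := by
        rw [Complex.norm_def, Complex.normSq_mk, show m * m + n * n = ρ ^ 2 by rw [hmn]; ring,
          Real.sqrt_sq hρ.le]
      rw [← hnorm]
    · exact (Complex.norm_mul_cos_arg ⟨m, n⟩).symm
    · exact (Complex.norm_mul_sin_arg ⟨m, n⟩).symm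
  have : T u v v = ρ * σ ^ 2 * (Real.cos α * T v₁ v₁ v₁ + Real.sin α * T v₂ v₁ v₁) := by
    rw [huw, hv2, hvv, h1, h2]; simp; ring
  rw [this, abs_mul, abs_of_pos (by positivity)]
  have := hbound α
  calc ρ * σ ^ 2 * _ ≤ ρ * σ ^ 2 * K := by gcongr
    _ = _ := by ring

/-- Polarization: combining the bounds at `s` and `-s` cancels `P`, `R` and `M` and leaves `2|s Q| ≤
κ (A + s² N)`, whose discriminant gives the claim. -/
theorem abs_le_of_forall_quadratic {P Q R A M N κ : ℝ} (hκ : 0 ≤ κ) (hA : 0 ≤ A) (hN : 0 ≤ N)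
    (h : ∀ s : ℝ, |P + 2 * s * Q + s ^ 2 * R| ≤ κ * (A + 2 * s * M + s ^ 2 * N)) :
    |Q| ≤ κ * (Real.sqrt A * Real.sqrt N) := by
  have h1 : ∀ s : ℝ, 0 ≤ (κ * N) * (s * s) + (-2 * |Q|) * s + κ * A := by
    intro s
    have a1 := abs_le.1 (h s)
    have a2 := abs_le.1 (h (-s))
    rcases abs_cases Q with ⟨hq, -⟩ | ⟨hq, -⟩ <;> rw [hq] <;> nlinarith [a1.1, a1.2, a2.1, a2.2]
  have h2 := discrim_le_zero h1
  rw [discrim] at h2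
  have h3 : |Q| ^ 2 ≤ (κ * (Real.sqrt A * Real.sqrt N)) ^ 2 := by
    rw [mul_pow, mul_pow, Real.sq_sqrt hA, Real.sq_sqrt hN]; nlinarith
  exact le_of_sq_le_sq h3 (by positivity)

theorem bilin_cauchy_schwarz {B : E →L[ℝ] E →L[ℝ] ℝ} (hB : ∀ u v, B u v = B v u)
    (hn : ∀ u, 0 ≤ B u u) (u v : E) : |B u v| ≤ Real.sqrt (B u u) * Real.sqrt (B v v) := by
  have := abs_le_of_forall_quadratic (P := B u u) (Q := B u v) (R := B v v) (A := B u u)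
    (M := B u v) (N := B v v) (κ := 1) zero_le_one (hn u) (hn v) fun s => by
      have : B u u + 2 * s * B u v + s ^ 2 * B v v = B (u + s • v) (u + s • v) := by
        simp [hB v u]; ring
      rw [this, one_mul, abs_of_nonneg (hn _)]
  simpa using this

/-- The representatives of one functional with respect to two comparable positive definite forms. -/
theorem bilin_rep_sub_le {B C : E →L[ℝ] E →L[ℝ] ℝ} (hB : ∀ u v, B u v = B v u)
    (hC : ∀ u v, C u v = C v u) (hBn : ∀ u, 0 ≤ B u u) (hCn : ∀ u, 0 ≤ C u u) {k : ℝ} (hk : 1 ≤ k)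
    (hCB : ∀ u, C u u ≤ k * B u u) (hBC : ∀ u, B u u ≤ k * C u u)
    (hsurj : ∀ v, ∃ v', C v' = B v) {a b : E} (hab : B a = C b) (v : E) :
    |B (a - b) v| ≤ (k - 1) * (Real.sqrt (B a a) * Real.sqrt (B v v)) := by
  have hk0 : 0 < k := by linarith
  -- The diagonal case. Here `B b a = C b b`, and two applications of Cauchy-Schwarz place `C b b`
  -- between `B a a / k` and `k * B a a`; the smaller gap `1 - 1/k` is at most `k - 1`.
  have quad : ∀ a b : E, B a = C b → |B (a - b) a| ≤ (k - 1) * B a a := by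
    intro a b hab
    have e1 : B b a = C b b := by rw [hB, hab]
    have e2 : B a a = C a b := by rw [hab, hC]
    have cs1 := bilin_cauchy_schwarz hB hBn b a
    have cs2 := bilin_cauchy_schwarz hC hCn a b
    rw [e1, abs_of_nonneg (hCn b)] at cs1
    rw [← e2, abs_of_nonneg (hBn a)] at cs2
    have i1 : C b b ^ 2 ≤ B b b * B a a := by
      calc C b b ^ 2 ≤ (Real.sqrt (B b b) * Real.sqrt (B a a)) ^ 2 := by
            gcongr; exact hCn b
        _ = _ := by rw [mul_pow, Real.sq_sqrt (hBn _), Real.sq_sqrt (hBn _)]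
    have i2 : B a a ^ 2 ≤ C a a * C b b := by
      calc B a a ^ 2 ≤ (Real.sqrt (C a a) * Real.sqrt (C b b)) ^ 2 := by
            gcongr; exact hBn a
        _ = _ := by rw [mul_pow, Real.sq_sqrt (hCn _), Real.sq_sqrt (hCn _)]
    have j1 : C b b ≤ k * B a a := by
      by_contra! hcon
      have : 0 < C b b := lt_of_le_of_lt (mul_nonneg hk0.le (hBn a)) hcon
      nlinarith [hBC b, hBn a]
    have j2 : B a a ≤ k * C b b := by
      by_contra! hcon
      have : 0 < B a a := lt_of_le_of_lt (mul_nonneg hk0.le (hCn b)) hcon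
      nlinarith [hCB a, hCn b]
    rw [map_sub, sub_apply, e1, abs_le]
    constructor
    · nlinarith
    · nlinarith [hBn a, hCn b, mul_le_mul_of_nonneg_left j2 (sub_nonneg.2 hk)]
  obtain ⟨v', hv'⟩ := hsurj v
  refine abs_le_of_forall_quadratic (P := B (a - b) a) (Q := B (a - b) v) (R := B (v - v') v)
    (A := B a a) (M := B a v) (N := B v v) (by linarith) (hBn a) (hBn v) fun s => ?_
  -- The pairs `(a, b)` and `(v, v')` each represent one functional, hence so does every
  -- combination, and polarization applies.
  have h1 := quad (a + s • v) (b + s • v') (by simp [hab, hv'])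
  have e1 : B (a + s • v) (a + s • v) = B a a + 2 * s * B a v + s ^ 2 * B v v := by
    simp [hB v a]; ring
  have e3 : B v' a = B b v := by
    rw [hB v' a, hab, hC, hv', hB]
  have e2 : B (a + s • v - (b + s • v')) (a + s • v) =
      B (a - b) a + 2 * s * B (a - b) v + s ^ 2 * B (v - v') v := by
    simp [e3, hB v a]; ring
  rwa [e1, e2] at h1

/-! ### Self-concordant functions: Dikin ellipsoid and comparison of Hessians -/

namespace BddSelfConcordant

variable {D : Set E} {f : E → ℝ} (h : BddSelfConcordant D f) {x z : E}
include h

theorem contDiffAt (hx : x ∈ D) : ContDiffAt ℝ 3 f x :=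
  h.contDiffOn.contDiffAt (h.isOpen.mem_nhds hx)

theorem D2_symm (hx : x ∈ D) (u v : E) : D2 f x u v = D2 f x v u :=
  ContDiffAt.D2_symm (h.contDiffAt hx) u v

theorem line_mem (hx : x ∈ D) (hz : z ∈ D) {s : ℝ} (hs : s ∈ Icc (0 : ℝ) 1) :
    x + s • (z - x) ∈ D := h.convexOn.1.add_smul_sub_mem hx hz hs

theorem D2_nonneg (hx : x ∈ D) (u : E) : 0 ≤ D2 f x u u := by
  have hS : IsOpen {s : ℝ | x + s • u ∈ D} :=
    h.isOpen.preimage (by fun_prop : Continuous fun s : ℝ => x + s • u)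
  have hconv : ConvexOn ℝ {s : ℝ | x + s • u ∈ D} (fun s : ℝ => f (x + s • u)) := by
    have := h.convexOn.comp_affineMap (AffineMap.lineMap x (x + u) : ℝ →ᵃ[ℝ] E)
    have e : ∀ s : ℝ, (AffineMap.lineMap x (x + u) : ℝ →ᵃ[ℝ] E) s = x + s • u := by
      intro s; rw [AffineMap.lineMap_apply]; simp [add_comm]
    have e2 : f ∘ (AffineMap.lineMap x (x + u) : ℝ →ᵃ[ℝ] E) = fun s : ℝ => f (x + s • u) := by
      funext s; simp only [Function.comp, e]
    have e3 : (AffineMap.lineMap x (x + u) : ℝ →ᵃ[ℝ] E) ⁻¹' D = {s : ℝ | x + s • u ∈ D} := by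
      ext s; simp only [mem_preimage, e, mem_ofPred_eq]
    rwa [e2, e3] at this
  have hd : ∀ s ∈ {s : ℝ | x + s • u ∈ D}, HasDerivAt (fun s : ℝ => f (x + s • u))
      (fderiv ℝ f (x + s • u) u) s := fun s hs =>
    ContDiffAt.hasDerivAt_line u s (h.contDiffAt hs)
  have hmono := hconv.monotoneOn_deriv fun s hs => (hd s hs).differentiableAt
  have h0 : (0 : ℝ) ∈ {s : ℝ | x + s • u ∈ D} := by simpa using hx
  have h2 := ContDiffAt.hasDerivAt_line_fderiv (x := x) u u 0 (f := f)
    (by simpa using h.contDiffAt hx)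
  rw [zero_smul, add_zero] at h2
  rw [hasDerivAt_iff_tendsto_slope] at h2
  refine ge_of_tendsto (h2.mono_left (nhdsGT_le_nhdsNE 0)) ?_
  filter_upwards [self_mem_nhdsWithin, nhdsWithin_le_nhds (hS.mem_nhds h0)] with s hs hsD
  rw [slope_def_field]
  refine div_nonneg (sub_nonneg.2 ?_) (sub_nonneg.2 (le_of_lt hs))
  have := hmono h0 hsD (le_of_lt hs)
  rwa [(hd 0 h0).deriv, (hd s hsD).deriv] at this

theorem lnorm_sq (hx : x ∈ D) (u : E) : lnorm f x u ^ 2 = D2 f x u u :=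
  Real.sq_sqrt (h.D2_nonneg hx u)

/-- Along a segment inside the domain, `1 / √(D²f[u,u] + ε)` is `1`-Lipschitz. -/
theorem inv_sqrt_lipschitz {u : E} {S : Set ℝ} (hS : Convex ℝ S)
    (hmem : ∀ s ∈ S, x + s • u ∈ D) {ε : ℝ} (hε : 0 ≤ ε)
    (hpos : ∀ s ∈ S, 0 < D2 f (x + s • u) u u + ε) {a b : ℝ} (ha : a ∈ S) (hb : b ∈ S) :
    |(Real.sqrt (D2 f (x + b • u) u u + ε))⁻¹ - (Real.sqrt (D2 f (x + a • u) u u + ε))⁻¹|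
      ≤ |b - a| := by
  have hd : ∀ s ∈ S, HasDerivWithinAt (fun s : ℝ => (Real.sqrt (D2 f (x + s • u) u u + ε))⁻¹)
      (-(D3 f (x + s • u) u u u / (2 * Real.sqrt (D2 f (x + s • u) u u + ε)))
        / Real.sqrt (D2 f (x + s • u) u u + ε) ^ 2) S s := by
    intro s hs
    have h1 := (ContDiffAt.hasDerivAt_line_D2 u u u s (h.contDiffAt (hmem s hs))).add_const ε
    exact ((h1.sqrt (hpos s hs).ne').inv (Real.sqrt_pos.2 (hpos s hs)).ne').hasDerivWithinAt
  have := hS.norm_image_sub_le_of_norm_hasDerivWithin_le (C := 1) hd ?_ ha hb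
  · simpa using this
  · intro s hs
    have hp := Real.sqrt_pos.2 (hpos s hs)
    have h3 := h.third_le _ (hmem s hs) u
    have hle : Real.sqrt (D2 f (x + s • u) u u) ≤ Real.sqrt (D2 f (x + s • u) u u + ε) :=
      Real.sqrt_le_sqrt (by linarith)
    rw [Real.norm_eq_abs, abs_div, abs_neg, abs_div, abs_of_pos (by positivity : 0 < 2 * Real.sqrt _),
      abs_of_pos (by positivity : 0 < Real.sqrt _ ^ 2), div_div, div_le_one (by positivity)]
    calc _ ≤ _ := h3
      _ ≤ 2 * Real.sqrt (D2 f (x + s • u) u u + ε) ^ 3 := by gcongr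
      _ = _ := by ring

/-- The Dikin ellipsoid of radius one is contained in the domain. -/
theorem dikin (hx : x ∈ D) {u : E} (hu : lnorm f x u < 1) : x + u ∈ D := by
  by_contra hcon
  set N : Set ℝ := Icc 0 1 ∩ (fun s : ℝ => x + s • u) ⁻¹' Dᶜ with hN
  have hNc : IsCompact N := isCompact_Icc.inter_right
    (h.isOpen.isClosed_compl.preimage (by fun_prop : Continuous fun s : ℝ => x + s • u))
  -- `T` is the first time at which the segment leaves the domain. Before `T` the second derivative
  -- along it will be bounded, hence so will `f`, and the closed sublevel set then contains the exit
  -- point.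
  obtain ⟨T, ⟨hT01, hTD⟩, hTmin⟩ := hNc.exists_isLeast ⟨1, by simp, by simpa using hcon⟩
  have hmem : ∀ s ∈ Ico 0 T, x + s • u ∈ D := by
    intro s hs
    by_contra hsD
    exact absurd (hTmin ⟨⟨hs.1, hs.2.le.trans hT01.2⟩, hsD⟩) (not_le.2 hs.2)
  have hT0 : 0 < T := by
    rcases hT01.1.lt_or_eq with h0 | h0
    · exact h0
    · exact absurd hx (by simpa [← h0] using hTD)
  have h0mem : (0 : ℝ) ∈ Ico 0 T := ⟨le_rfl, hT0⟩
  set r2 := D2 f x u u with hr2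
  have hr0 : 0 ≤ r2 := h.D2_nonneg hx u
  have hr1 : r2 < 1 := by
    have := hu; rw [lnorm, Real.sqrt_lt' one_pos] at this; simpa using this
  -- The shift avoids dividing by a Hessian not yet known to be definite; this choice keeps `r2 + ε`
  -- below 1.
  set ε := (1 - r2) / 2 with hε
  have hε0 : 0 < ε := by rw [hε]; linarith
  have hlip := fun s (hs : s ∈ Ico 0 T) => h.inv_sqrt_lipschitz (x := x) (u := u) (convex_Ico 0 T)
    hmem hε0.le (fun s hs => by have := h.D2_nonneg (hmem s hs) u; linarith) h0mem hs
  simp only [zero_smul, add_zero, sub_zero] at hlip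
  rw [← hr2] at hlip
  set κ := (Real.sqrt (r2 + ε))⁻¹ - 1 with hκ
  have hκ0 : 0 < κ := by
    have h1 : 0 < Real.sqrt (r2 + ε) := Real.sqrt_pos.2 (by linarith)
    have h2 : Real.sqrt (r2 + ε) < 1 := by
      rw [Real.sqrt_lt' one_pos]; rw [hε]; linarith
    have := (one_lt_inv₀ h1).2 h2
    linarith
  have hq : ∀ s ∈ Ico 0 T, |D2 f (x + s • u) u u| ≤ (κ⁻¹) ^ 2 := by
    intro s hs
    have hn := h.D2_nonneg (hmem s hs) u
    have h1 := (abs_le.1 (hlip s hs)).1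
    rw [abs_of_nonneg hs.1] at h1
    have h2 : κ ≤ (Real.sqrt (D2 f (x + s • u) u u + ε))⁻¹ := by
      have := hs.2.le.trans hT01.2
      linarith
    have h3 : Real.sqrt (D2 f (x + s • u) u u + ε) ≤ κ⁻¹ := by
      rw [← inv_inv (Real.sqrt _)]; exact inv_anti₀ hκ0 h2
    rw [abs_of_nonneg hn]
    have := Real.sqrt_le_iff.1 h3
    linarith [this.2]
  have hb1 : ∀ s ∈ Ico 0 T, |fderiv ℝ f (x + s • u) u| ≤ |fderiv ℝ f x u| + (κ⁻¹) ^ 2 := by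
    intro s hs
    have := (convex_Ico 0 T).norm_image_sub_le_of_norm_hasDerivWithin_le
      (f := fun s : ℝ => fderiv ℝ f (x + s • u) u)
      (fun s hs => (ContDiffAt.hasDerivAt_line_fderiv u u s
        (h.contDiffAt (hmem s hs))).hasDerivWithinAt) hq h0mem hs
    simp only [zero_smul, add_zero, sub_zero, Real.norm_eq_abs, abs_of_nonneg hs.1] at this
    have h4 : (κ⁻¹) ^ 2 * s ≤ (κ⁻¹) ^ 2 :=
      mul_le_of_le_one_right (by positivity) (hs.2.le.trans hT01.2)
    have := abs_sub_abs_le_abs_sub (fderiv ℝ f (x + s • u) u) (fderiv ℝ f x u)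
    linarith
  set L := |fderiv ℝ f x u| + (κ⁻¹) ^ 2 with hL
  have hL0 : 0 ≤ L := by positivity
  have hb0 : ∀ s ∈ Ico 0 T, f (x + s • u) ≤ f x + L := by
    intro s hs
    have := (convex_Ico 0 T).norm_image_sub_le_of_norm_hasDerivWithin_le
      (f := fun s : ℝ => f (x + s • u))
      (fun s hs => (ContDiffAt.hasDerivAt_line u s
        (h.contDiffAt (hmem s hs))).hasDerivWithinAt) hb1 h0mem hs
    simp only [zero_smul, add_zero, sub_zero, Real.norm_eq_abs, abs_of_nonneg hs.1] at this
    have h4 : L * s ≤ L := mul_le_of_le_one_right hL0 (hs.2.le.trans hT01.2)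
    have := le_abs_self (f (x + s • u) - f x)
    linarith
  have hclos : T ∈ closure (Ico 0 T) := by
    rw [closure_Ico hT0.ne]; exact ⟨hT0.le, le_rfl⟩
  have hsub : Ico 0 T ⊆ (fun s : ℝ => x + s • u) ⁻¹' {y | y ∈ D ∧ f y ≤ f x + L} :=
    fun s hs => ⟨hmem s hs, hb0 s hs⟩
  have hcl := (h.isClosed_sublevel (f x + L)).preimage
    (by fun_prop : Continuous fun s : ℝ => x + s • u)
  exact hTD (closure_minimal hsub hcl hclos).1

/-- A degenerate direction `u` has local norm zero at every scale, so the Dikin ellipsoid would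
contain the whole line `x + s u`, against boundedness. -/
theorem D2_pos (hx : x ∈ D) {u : E} (hu : u ≠ 0) : 0 < D2 f x u u := by
  refine lt_of_le_of_ne (h.D2_nonneg hx u) fun h0 => ?_
  obtain ⟨R, hR⟩ := h.bounded.exists_norm_le
  have hn : 0 < ‖u‖ := norm_pos_iff.2 hu
  set s := (R + ‖x‖ + 1) / ‖u‖ with hs
  have hmem : x + s • u ∈ D := h.dikin hx (by simp [lnorm, ← h0])
  have h1 := hR _ hmem
  have h2 : ‖s • u‖ ≤ ‖x + s • u‖ + ‖x‖ := by
    have := norm_sub_le (x + s • u) x; simpa using this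
  rw [norm_smul, Real.norm_eq_abs] at h2
  have h3 : |s| * ‖u‖ ≥ R + ‖x‖ + 1 := by
    have : s * ‖u‖ = R + ‖x‖ + 1 := by rw [hs]; field_simp
    rw [← this]; gcongr; exact le_abs_self s
  linarith

theorem lnorm_pos (hx : x ∈ D) {u : E} (hu : u ≠ 0) : 0 < lnorm f x u :=
  Real.sqrt_pos.2 (h.D2_pos hx hu)

theorem abs_D2_le (hx : x ∈ D) (u v : E) : |D2 f x u v| ≤ lnorm f x u * lnorm f x v :=
  bilin_cauchy_schwarz (h.D2_symm hx) (h.D2_nonneg hx) u v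

theorem lnorm_add_le (hx : x ∈ D) (u v : E) : lnorm f x (u + v) ≤ lnorm f x u + lnorm f x v := by
  have h1 := (abs_le.1 (h.abs_D2_le hx u v)).2
  refine Real.sqrt_le_iff.2 ⟨add_nonneg (Real.sqrt_nonneg _) (Real.sqrt_nonneg _), ?_⟩
  have e : D2 f x (u + v) (u + v) = D2 f x u u + 2 * D2 f x u v + D2 f x v v := by
    simp [h.D2_symm hx v u]; ring
  rw [e, ← h.lnorm_sq hx, ← h.lnorm_sq hx]
  nlinarith

/-- Self-concordance controls only the diagonal of the third derivative; Banach's inequality extends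
it with the same constant 2. -/
theorem abs_D3_le (hx : x ∈ D) (u v : E) :
    |D3 f x u v v| ≤ 2 * lnorm f x u * D2 f x v v :=
  trilinear_le_of_diag (h.D2_symm hx) (fun _ hu => h.D2_pos hx hu)
    (ContDiffAt.D3_symm_left (h.contDiffAt hx)) (ContDiffAt.D3_symm_right (h.contDiffAt hx))
    (h.third_le x hx) u v

/-- Comparison of the Hessians at the ends of a segment from a scalar differential inequality. -/
theorem D2_compare (hx : x ∈ D) (hz : z ∈ D) {m m' : ℝ → ℝ}
    (hm : ∀ s ∈ Icc (0 : ℝ) 1, HasDerivAt m (m' s) s) (hm0 : ∀ s ∈ Icc (0 : ℝ) 1, 0 < m s)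
    (hmm : ∀ s ∈ Icc (0 : ℝ) 1, m' s ≤ -(lnorm f (x + s • (z - x)) (z - x) * m s)) (v : E) :
    D2 f z v v * m 1 ^ 2 ≤ D2 f x v v * m 0 ^ 2 ∧ D2 f x v v * m 1 ^ 2 ≤ D2 f z v v * m 0 ^ 2 := by
  set u := z - x with hu
  have hd : ∀ s ∈ Icc (0 : ℝ) 1, HasDerivAt (fun s : ℝ => D2 f (x + s • u) v v)
      (D3 f (x + s • u) u v v) s := fun s hs =>
    ContDiffAt.hasDerivAt_line_D2 u v v s (h.contDiffAt (h.line_mem hx hz hs))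
  have hb := fun s (hs : s ∈ Icc (0 : ℝ) 1) => abs_le.1 (h.abs_D3_le (h.line_mem hx hz hs) u v)
  have hn := fun s (hs : s ∈ Icc (0 : ℝ) 1) => h.D2_nonneg (h.line_mem hx hz hs) v
  have h0 : (0 : ℝ) ∈ Icc (0 : ℝ) 1 := by simp
  have h1 : (1 : ℝ) ∈ Icc (0 : ℝ) 1 := by simp
  have d1 := fun s (hs : s ∈ Icc (0 : ℝ) 1) => (hd s hs).fun_mul ((hm s hs).fun_pow 2)
  have d2 := fun s (hs : s ∈ Icc (0 : ℝ) 1) =>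
    (hd s hs).fun_div ((hm s hs).fun_pow 2) (pow_pos (hm0 s hs) 2).ne'
  -- With `Q(s)` the Hessian value at `v` and `φ` the local norm of the velocity, `|Q'| ≤ 2 φ Q` and
  -- `m' ≤ -φ m`. So `Q m²` decreases and `Q / m²` increases.
  have m1 : AntitoneOn (fun s : ℝ => D2 f (x + s • u) v v * m s ^ 2) (Icc 0 1) := by
    refine antitoneOn_of_deriv_nonpos (convex_Icc 0 1)
      (fun s hs => (d1 s hs).continuousAt.continuousWithinAt)
      (fun s hs => (d1 s (interior_subset hs)).differentiableAt.differentiableWithinAt)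
      fun s hs => ?_
    have hs := interior_subset hs
    rw [(d1 s hs).deriv]
    have a1 : D3 f (x + s • u) u v v * m s ^ 2 ≤
      2 * lnorm f (x + s • u) u * D2 f (x + s • u) v v * m s ^ 2 :=
      mul_le_mul_of_nonneg_right (hb s hs).2 (sq_nonneg _)
    have a2 : D2 f (x + s • u) v v * (2 * m s) * m' s ≤
        D2 f (x + s • u) v v * (2 * m s) * -(lnorm f (x + s • u) u * m s) :=
      mul_le_mul_of_nonneg_left (hmm s hs) (mul_nonneg (hn s hs) (by linarith [hm0 s hs]))
    simp only [Nat.cast_ofNat, Nat.add_one_sub_one, pow_one]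
    linarith
  have m2 : MonotoneOn (fun s : ℝ => D2 f (x + s • u) v v / m s ^ 2) (Icc 0 1) := by
    refine monotoneOn_of_deriv_nonneg (convex_Icc 0 1)
      (fun s hs => (d2 s hs).continuousAt.continuousWithinAt)
      (fun s hs => (d2 s (interior_subset hs)).differentiableAt.differentiableWithinAt)
      fun s hs => ?_
    have hs := interior_subset hs
    rw [(d2 s hs).deriv]
    have a1 : -(2 * lnorm f (x + s • u) u * D2 f (x + s • u) v v) * m s ^ 2 ≤
      D3 f (x + s • u) u v v * m s ^ 2 :=
      mul_le_mul_of_nonneg_right (hb s hs).1 (sq_nonneg _)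
    have a2 : D2 f (x + s • u) v v * (2 * m s) * m' s ≤
        D2 f (x + s • u) v v * (2 * m s) * -(lnorm f (x + s • u) u * m s) :=
      mul_le_mul_of_nonneg_left (hmm s hs) (mul_nonneg (hn s hs) (by linarith [hm0 s hs]))
    refine div_nonneg ?_ (by positivity)
    simp only [Nat.cast_ofNat, Nat.add_one_sub_one, pow_one]
    linarith
  have e1 := m1 h0 h1 zero_le_one
  have e2 := m2 h0 h1 zero_le_one
  simp only [zero_smul, add_zero, one_smul, hu, add_sub_cancel] at e1 e2
  refine ⟨e1, ?_⟩
  rwa [div_le_div_iff₀ (pow_pos (hm0 0 h0) 2) (pow_pos (hm0 1 h1) 2)] at e2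

/-- Comparison of the Hessians at two points whose local distance is less than one. -/
theorem D2_compare_of_lnorm_lt_one (hx : x ∈ D) {u : E} (hu : lnorm f x u < 1) (v : E) :
    D2 f (x + u) v v * (1 - lnorm f x u) ^ 2 ≤ D2 f x v v ∧
      D2 f x v v * (1 - lnorm f x u) ^ 2 ≤ D2 f (x + u) v v := by
  have hz := h.dikin hx hu
  by_cases hu0 : u = 0
  · simp [hu0, lnorm]
  set r := lnorm f x u with hr
  have hr0 : 0 < r := h.lnorm_pos hx hu0
  have hmem : ∀ s ∈ Icc (0 : ℝ) 1, x + s • u ∈ D := fun s hs => by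
    simpa using h.line_mem hx hz hs
  have := h.D2_compare hx hz (m := fun s => 1 - s * r) (m' := fun _ => -r)
    (fun s hs => by simpa using ((hasDerivAt_id s).mul_const r).const_sub 1)
    (fun s hs => by nlinarith [hs.1, hs.2]) (fun s hs => ?_) v
  · simpa using this
  · rw [add_sub_cancel_left, neg_le_neg_iff]
    -- The Lipschitz bound gives `1/φ(s) ≥ 1/r - s`, that is `φ(s) (1 - s r) ≤ r`, the inequality
    -- required of the weight.
    have h1 := (abs_le.1 (h.inv_sqrt_lipschitz (convex_Icc 0 1) hmem le_rfl
      (fun s hs => by simpa using h.D2_pos (hmem s hs) hu0) (by simp : (0 : ℝ) ∈ Icc (0 : ℝ) 1)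
      hs)).1
    simp only [zero_smul, add_zero, sub_zero, abs_of_nonneg hs.1] at h1
    have hφ := h.lnorm_pos (hmem s hs) hu0
    change -s ≤ (lnorm f (x + s • u) u)⁻¹ - r⁻¹ at h1
    set φ := lnorm f (x + s • u) u
    have h2 : r⁻¹ - s ≤ φ⁻¹ := by linarith
    have h3 := mul_le_mul_of_nonneg_left h2 (mul_pos hφ hr0).le
    have e1 : φ * r * (r⁻¹ - s) = φ * (1 - s * r) := by field_simp
    have e2 : φ * r * φ⁻¹ = r := by field_simp
    rwa [e1, e2] at h3

/-- Comparison of the Hessians at two points whose gradients are close in the dual local norm. -/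
theorem D2_compare_of_grad (hx : x ∈ D) (hz : z ∈ D) {w : E}
    (hw : D2 f x w = fderiv ℝ f z - fderiv ℝ f x) (hw1 : lnorm f x w < 1) (v : E) :
    D2 f z v v * (1 - lnorm f x w) ^ 2 ≤ D2 f x v v ∧
      D2 f x v v * (1 - lnorm f x w) ^ 2 ≤ D2 f z v v := by
  set u := z - x with hu
  set lam := lnorm f x w
  have hlam0 : 0 ≤ lam := Real.sqrt_nonneg _
  by_cases hu0 : u = 0
  · have : z = x := sub_eq_zero.1 hu0
    subst this
    have := h.D2_nonneg hx v
    have h1 : D2 f z v v * (1 - lam) ^ 2 ≤ D2 f z v v :=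
      mul_le_of_le_one_right this (pow_le_one₀ (by linarith) (by linarith))
    exact ⟨h1, h1⟩
  have hmem : ∀ s ∈ Icc (0 : ℝ) 1, x + s • u ∈ D := fun s hs => h.line_mem hx hz hs
  have h0 : (0 : ℝ) ∈ Icc (0 : ℝ) 1 := by simp
  have h1 : (1 : ℝ) ∈ Icc (0 : ℝ) 1 := by simp
  have hφpos : ∀ s ∈ Icc (0 : ℝ) 1, 0 < lnorm f (x + s • u) u :=
    fun s hs => h.lnorm_pos (hmem s hs) hu0
  set r := lnorm f x u with hr
  have hr0 : 0 < r := h.lnorm_pos hx hu0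
  set g : ℝ → ℝ := fun s => fderiv ℝ f (x + s • u) u with hg
  have hgd : ∀ s ∈ Icc (0 : ℝ) 1, HasDerivAt g (lnorm f (x + s • u) u ^ 2) s := fun s hs => by
    rw [h.lnorm_sq (hmem s hs)]
    exact ContDiffAt.hasDerivAt_line_fderiv u u s (h.contDiffAt (hmem s hs))
  have kd : ∀ s ∈ Icc (0 : ℝ) 1, HasDerivAt (fun s : ℝ => lnorm f (x + s • u) u + g s)
      (D3 f (x + s • u) u u u / (2 * lnorm f (x + s • u) u) + lnorm f (x + s • u) u ^ 2) s :=
    fun s hs => ((ContDiffAt.hasDerivAt_line_D2 u u u s (h.contDiffAt (hmem s hs))).sqrt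
      (h.D2_pos (hmem s hs) hu0).ne').add (hgd s hs)
  -- Self-concordance gives `φ' ≥ -φ²`, while `g' = φ²`. Hence `φ(s) ≥ r - (g(s) - g(0)) = r m(s)`,
  -- so `φ m ≤ φ²/r = -m'`. No bound on the distance from `x` to `z` is needed.
  have kmono : MonotoneOn (fun s : ℝ => lnorm f (x + s • u) u + g s) (Icc 0 1) := by
    refine monotoneOn_of_deriv_nonneg (convex_Icc 0 1)
      (fun s hs => (kd s hs).continuousAt.continuousWithinAt)
      (fun s hs => (kd s (interior_subset hs)).differentiableAt.differentiableWithinAt)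
      fun s hs => ?_
    have hs := interior_subset hs
    rw [(kd s hs).deriv]
    have h3 := (abs_le.1 (h.third_le _ (hmem s hs) u)).1
    change -(2 * lnorm f (x + s • u) u ^ 3) ≤ _ at h3
    have hp := hφpos s hs
    have : -lnorm f (x + s • u) u ^ 2 ≤ D3 f (x + s • u) u u u / (2 * lnorm f (x + s • u) u) := by
      rw [le_div_iff₀ (by positivity)]; nlinarith
    linarith
  have hgmono : MonotoneOn g (Icc 0 1) :=
    monotoneOn_of_deriv_nonneg (convex_Icc 0 1)
      (fun s hs => (hgd s hs).continuousAt.continuousWithinAt)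
      (fun s hs => (hgd s (interior_subset hs)).differentiableAt.differentiableWithinAt)
      fun s hs => by rw [(hgd s (interior_subset hs)).deriv]; positivity
  -- The total increase of `g` is the pairing of `w` with `u`, so Cauchy-Schwarz yields `m 1 ≥ 1 -
  -- lam`.
  have hg1 : g 1 - g 0 ≤ lam * r := by
    have : g 1 - g 0 = D2 f x w u := by
      rw [hw]; simp [hg, hu]
    rw [this]
    exact (le_abs_self _).trans (h.abs_D2_le hx w u)
  have hm1 : 1 - lam ≤ 1 - (g 1 - g 0) / r := by
    have : (g 1 - g 0) / r ≤ lam := (div_le_iff₀ hr0).2 hg1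
    linarith
  have key := h.D2_compare hx hz (m := fun s => 1 - (g s - g 0) / r)
    (m' := fun s => -(lnorm f (x + s • u) u ^ 2 / r))
    (fun s hs => (((hgd s hs).sub_const _).div_const r).const_sub 1)
    (fun s hs => ?_) (fun s hs => ?_) v
  · have e : (1 - lam) ^ 2 ≤ (1 - (g 1 - g 0) / r) ^ 2 :=
      pow_le_pow_left₀ (by linarith) hm1 2
    have n1 := h.D2_nonneg hx v
    have n2 := h.D2_nonneg hz v
    simp only [sub_self, zero_div, sub_zero, one_pow, mul_one] at key
    exact ⟨(mul_le_mul_of_nonneg_left e n2).trans key.1, (mul_le_mul_of_nonneg_left e n1).trans key.2⟩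
  · have := hgmono hs h1 hs.2
    have : (g s - g 0) / r ≤ (g 1 - g 0) / r := by gcongr
    linarith
  · rw [neg_le_neg_iff]
    have hk := kmono h0 hs hs.1
    simp only [zero_smul, add_zero] at hk
    have hp := hφpos s hs
    change lnorm f (x + s • u) u * (1 - (g s - g 0) / r) ≤ _
    change r + g 0 ≤ _ at hk
    rw [le_div_iff₀ hr0]
    have : lnorm f (x + s • u) u * (1 - (g s - g 0) / r) * r =
      lnorm f (x + s • u) u * (r - (g s - g 0)) := by field_simp
    rw [this]
    nlinarith

end BddSelfConcordant
end SelfConcordant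

/-! ### The gradient map as a bijection onto the dual space -/

section SelfConcordant
variable {E : Type*} [NormedAddCommGroup E] [NormedSpace ℝ E] [FiniteDimensional ℝ E]

namespace BddSelfConcordant
variable {D : Set E} {f : E → ℝ} (h : BddSelfConcordant D f) {x z : E}
include h

theorem isCompact_sublevel (a : ℝ) : IsCompact {x | x ∈ D ∧ f x ≤ a} :=
  Metric.isCompact_of_isClosed_isBounded (h.isClosed_sublevel a)
    (h.bounded.subset fun _ hx => hx.1)

/-- On the bounded domain `ℓ` varies by at most `2‖ℓ‖R`, so a point outside the compact sublevel set
at `f x₀ + 2‖ℓ‖R` cannot do better than `x₀`. -/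
theorem exists_isMinOn_sub (hne : D.Nonempty) (ℓ : E →L[ℝ] ℝ) :
    ∃ x ∈ D, IsMinOn (fun y => f y - ℓ y) D x := by
  obtain ⟨x₀, hx₀⟩ := hne
  obtain ⟨R, hR⟩ := h.bounded.exists_norm_le
  have hR0 : 0 ≤ R := (norm_nonneg _).trans (hR _ hx₀)
  have hℓ : ∀ y ∈ D, |ℓ y| ≤ ‖ℓ‖ * R := fun y hy =>
    (ℓ.le_opNorm y).trans (mul_le_mul_of_nonneg_left (hR y hy) (norm_nonneg _))
  set a := f x₀ + 2 * (‖ℓ‖ * R)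
  have hL : 0 ≤ ‖ℓ‖ * R := by positivity
  have hx₀K : x₀ ∈ {x | x ∈ D ∧ f x ≤ a} := ⟨hx₀, by simp only [a]; linarith⟩
  have hcont : ContinuousOn (fun y => f y - ℓ y) {x | x ∈ D ∧ f x ≤ a} :=
    (h.contDiffOn.continuousOn.mono fun _ hx => hx.1).sub ℓ.continuous.continuousOn
  obtain ⟨x, hxK, hmin⟩ := (h.isCompact_sublevel a).exists_isMinOn ⟨x₀, hx₀K⟩ hcont
  refine ⟨x, hxK.1, fun y hy => ?_⟩
  by_cases hya : f y ≤ a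
  · exact hmin ⟨hy, hya⟩
  · have h1 : f x - ℓ x ≤ f x₀ - ℓ x₀ := hmin hx₀K
    have h2 := abs_le.1 (hℓ _ hx₀)
    have h3 := abs_le.1 (hℓ _ hy)
    change f x - ℓ x ≤ f y - ℓ y
    push Not at hya
    simp only [a] at hya
    linarith

theorem exists_fderiv_eq (hne : D.Nonempty) (ℓ : E →L[ℝ] ℝ) : ∃ x ∈ D, fderiv ℝ f x = ℓ := by
  obtain ⟨x, hx, hmin⟩ := h.exists_isMinOn_sub hne ℓ
  refine ⟨x, hx, ?_⟩
  have hd := (ContDiffAt.hasFDerivAt_one (h.contDiffAt hx)).sub ℓ.hasFDerivAt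
  exact sub_eq_zero.1 ((hmin.isLocalMin (h.isOpen.mem_nhds hx)).hasFDerivAt_eq_zero hd)

omit [FiniteDimensional ℝ E] in
theorem fderiv_injOn : InjOn (fderiv ℝ f) D := by
  intro x hx z hz hxz
  by_contra hne
  set u := z - x with hu
  have hu0 : u ≠ 0 := sub_ne_zero.2 (Ne.symm hne)
  have hd : ∀ s ∈ Icc (0 : ℝ) 1, HasDerivAt (fun s : ℝ => fderiv ℝ f (x + s • u) u)
      (D2 f (x + s • u) u u) s := fun s hs =>
    ContDiffAt.hasDerivAt_line_fderiv u u s (h.contDiffAt (h.line_mem hx hz hs))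
  obtain ⟨c, hc, hc'⟩ := exists_hasDerivAt_eq_slope _ _ one_pos
    (fun s hs => (hd s hs).continuousAt.continuousWithinAt)
    (fun s hs => hd s (Ioo_subset_Icc_self hs))
  have := h.D2_pos (h.line_mem hx hz (Ioo_subset_Icc_self hc)) hu0
  rw [hc'] at this
  simp [hu, hxz] at this

/-- The Hessian at a point of the domain as an isomorphism onto the dual space. -/
theorem exists_equiv_D2 (hx : x ∈ D) :
    ∃ e : E ≃L[ℝ] (E →L[ℝ] ℝ), (e : E →L[ℝ] (E →L[ℝ] ℝ)) = D2 f x := by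
  have hinj : Function.Injective (D2 f x).toLinearMap := by
    rw [← LinearMap.ker_eq_bot, LinearMap.ker_eq_bot']
    intro u hu
    by_contra hu0
    have := h.D2_pos hx hu0
    change D2 f x u = 0 at hu
    simp [hu] at this
  have hfr : Module.finrank ℝ E = Module.finrank ℝ (E →L[ℝ] ℝ) := by
    rw [← (LinearMap.toContinuousLinearMap (𝕜 := ℝ) (E := E) (F' := ℝ)).finrank_eq]
    exact Subspace.dual_finrank_eq.symm
  refine ⟨(LinearMap.linearEquivOfInjective _ hinj hfr).toContinuousLinearEquiv, ?_⟩
  ext u v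
  simp

theorem exists_D2_eq (hx : x ∈ D) (ℓ : E →L[ℝ] ℝ) : ∃ w, D2 f x w = ℓ := by
  obtain ⟨e, he⟩ := h.exists_equiv_D2 hx
  exact ⟨e.symm ℓ, by rw [← he]; simp⟩

/-- The curve in the domain along which the gradient moves with constant velocity. -/
theorem exists_gradient_curve (hx : x ∈ D) (ω : E →L[ℝ] ℝ) :
    ∃ c w : ℝ → E, c 0 = x ∧ ∀ s, c s ∈ D ∧ fderiv ℝ f (c s) = fderiv ℝ f x + s • ω ∧
      HasDerivAt c (w s) s ∧ D2 f (c s) (w s) = ω := by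
  choose G hGD hG using h.exists_fderiv_eq ⟨x, hx⟩
  have hleft : ∀ y ∈ D, G (fderiv ℝ f y) = y := fun y hy =>
    h.fderiv_injOn (hGD _) hy (hG _)
  have hline : ∀ s : ℝ, HasDerivAt (fun s : ℝ => fderiv ℝ f x + s • ω) ω s := fun s => by
    simpa using ((hasDerivAt_id s).smul_const ω).const_add (fderiv ℝ f x)
  have key : ∀ s : ℝ, ∃ w, HasDerivAt (fun s : ℝ => G (fderiv ℝ f x + s • ω)) w s ∧
      D2 f (G (fderiv ℝ f x + s • ω)) w = ω := by
    intro s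
    set y := G (fderiv ℝ f x + s • ω) with hy
    have hyD : y ∈ D := hGD _
    obtain ⟨e, he⟩ := h.exists_equiv_D2 hyD
    have h1 := ContDiffAt.hasStrictFDerivAt_fderiv (h.contDiffAt hyD)
    rw [← he] at h1
    -- The inverse function theorem: the global inverse `G` of the gradient is also a local one, so
    -- its derivative is the inverse Hessian.
    have h2 := h1.to_local_left_inverse
      (Filter.eventually_of_mem (h.isOpen.mem_nhds hyD) hleft)
    rw [hG] at h2
    have h3 := HasFDerivAt.comp_hasDerivAt s h2.hasFDerivAt (hline s)
    exact ⟨e.symm ω, h3, by rw [← he]; simp⟩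
  choose w hw using key
  exact ⟨fun s => G (fderiv ℝ f x + s • ω), w, by simp [hleft x hx],
    fun s => ⟨hGD _, hG _, (hw s).1, (hw s).2⟩⟩

/-- The representatives of one functional at two points with comparable Hessians. -/
theorem D2_rep_sub_le (hx : x ∈ D) (hz : z ∈ D) {r : ℝ} (hr0 : 0 ≤ r) (hr1 : r < 1)
    (hxz : ∀ v, D2 f z v v * (1 - r) ^ 2 ≤ D2 f x v v ∧ D2 f x v v * (1 - r) ^ 2 ≤ D2 f z v v)
    {a b : E} (hab : D2 f x a = D2 f z b) (v : E) :
    |D2 f x (a - b) v| ≤ (((1 - r) ^ 2)⁻¹ - 1) * (lnorm f x a * lnorm f x v) := by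
  have hp : 0 < (1 - r) ^ 2 := pow_pos (by linarith) 2
  refine bilin_rep_sub_le (h.D2_symm hx) (h.D2_symm hz) (h.D2_nonneg hx) (h.D2_nonneg hz)
    ((one_le_inv₀ hp).2 (pow_le_one₀ (by linarith) (by linarith)))
    (fun u => ?_) (fun u => ?_) (fun v => h.exists_D2_eq hz _) hab v
  · rw [inv_mul_eq_div, le_div_iff₀ hp]; exact (hxz u).1
  · rw [inv_mul_eq_div, le_div_iff₀ hp]; exact (hxz u).2

/-- The error of the linearization of the inverse of the gradient map. -/
theorem lnorm_newton_error_le (hx : x ∈ D) (hz : z ∈ D) {w : E}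
    (hw : D2 f x w = fderiv ℝ f z - fderiv ℝ f x) (hw1 : lnorm f x w < 1) :
    lnorm f x (z - x - w) ≤ lnorm f x w ^ 2 / (1 - lnorm f x w) := by
  obtain ⟨c, w', hc0, hc⟩ := h.exists_gradient_curve hx (fderiv ℝ f z - fderiv ℝ f x)
  have hc1 : c 1 = z := h.fderiv_injOn (hc 1).1 hz (by rw [(hc 1).2.1]; simp)
  set lam := lnorm f x w with hlam
  have hlam0 : 0 ≤ lam := Real.sqrt_nonneg _
  set e := z - x - w with he
  set N := lnorm f x e with hN
  have hN0 : 0 ≤ N := Real.sqrt_nonneg _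
  have hpos : ∀ s ∈ Icc (0 : ℝ) 1, 0 < 1 - s * lam := fun s hs => by nlinarith [hs.1, hs.2]
  have hd : ∀ s ∈ Icc (0 : ℝ) 1, |D2 f x (w - w' s) e| ≤
      (((1 - s * lam) ^ 2)⁻¹ - 1) * (lam * N) := by
    intro s hs
    have hsw : lnorm f x (s • w) = s * lam := by
      simp only [lnorm, map_smul, FunLike.coe_smul, Pi.smul_apply, smul_eq_mul, hlam]
      rw [← mul_assoc, Real.sqrt_mul (mul_self_nonneg s), Real.sqrt_mul_self hs.1]
    have hcmp := fun v => h.D2_compare_of_grad hx (hc s).1 (w := s • w)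
      (by rw [map_smul, hw, (hc s).2.1]; simp) (by rw [hsw]; linarith [hpos s hs]) v
    rw [hsw] at hcmp
    exact h.D2_rep_sub_le hx (hc s).1 (mul_nonneg hs.1 hlam0) (by linarith [hpos s hs]) hcmp
      (by rw [hw, (hc s).2.2.2]) e
  -- An antiderivative of the bound in `hd`; its increase over `[0,1]` is `lam² / (1 - lam) * N`.
  -- The function `ψ` below pairs the deviation of the curve from its tangent with the error `e`,
  -- and increases by `N²`.
  set b : ℝ → ℝ := fun s => ((1 - s * lam)⁻¹ - s * lam) * N with hb
  set ψ : ℝ → ℝ := fun s => D2 f x e (c s - s • w) with hψ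
  have hψd : ∀ s, HasDerivAt ψ (D2 f x e (w' s - w)) s := fun s =>
    (D2 f x e).hasFDerivAt.comp_hasDerivAt s
      ((hc s).2.2.1.sub (by simpa using (hasDerivAt_id s).smul_const w))
  have hbd : ∀ s ∈ Icc (0 : ℝ) 1, HasDerivAt b ((((1 - s * lam) ^ 2)⁻¹ - 1) * (lam * N)) s := by
    intro s hs
    have h1 : HasDerivAt (fun s : ℝ => 1 - s * lam) (-lam) s := by
      simpa using ((hasDerivAt_id s).mul_const lam).const_sub 1
    have h2 : HasDerivAt (fun s : ℝ => s * lam) lam s := by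
      simpa using (hasDerivAt_id s).mul_const lam
    refine (((h1.fun_inv (hpos s hs).ne').sub h2).mul_const N).congr_deriv ?_
    have := (hpos s hs).ne'
    field_simp
  have hanti : AntitoneOn (fun s => ψ s - b s) (Icc 0 1) := by
    have hdd := fun s (hs : s ∈ Icc (0 : ℝ) 1) => (hψd s).sub (hbd s hs)
    refine antitoneOn_of_deriv_nonpos (convex_Icc 0 1)
      (fun s hs => (hdd s hs).continuousAt.continuousWithinAt)
      (fun s hs => (hdd s (interior_subset hs)).differentiableAt.differentiableWithinAt)
      fun s hs => ?_
    have hs := interior_subset hs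
    have e1 : D2 f x e (w' s - w) = -D2 f x (w - w' s) e := by
      rw [h.D2_symm hx]; simp
    have := (abs_le.1 (hd s hs)).1
    refine (hdd s hs).deriv.le.trans ?_
    rw [e1]; linarith
  have h01 := hanti (by simp : (0 : ℝ) ∈ Icc (0 : ℝ) 1) (by simp : (1 : ℝ) ∈ Icc (0 : ℝ) 1)
    zero_le_one
  have hψ1 : ψ 1 - ψ 0 = N ^ 2 := by
    rw [hN, h.lnorm_sq hx]
    simp only [hψ, hc1, hc0, one_smul, zero_smul, sub_zero]
    rw [← map_sub, show z - w - x = e by rw [he]; abel]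
  have hb1 : b 1 - b 0 = lam ^ 2 / (1 - lam) * N := by
    have : 1 - lam ≠ 0 := by linarith
    simp only [hb, one_mul, zero_mul, sub_zero]
    field_simp
    ring
  have hle : N * N ≤ lam ^ 2 / (1 - lam) * N := by
    simp only at h01; nlinarith
  rcases hN0.lt_or_eq with hN1 | hN1
  · exact le_of_mul_le_mul_right hle hN1
  · rw [← hN1]; exact div_nonneg (sq_nonneg _) (by linarith)

end BddSelfConcordant
end SelfConcordant

/-! ### Transport of local norms and the residual of one inexact step -/

section SelfConcordant
variable {E : Type*} [NormedAddCommGroup E] [NormedSpace ℝ E]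

theorem lnorm_neg (f : E → ℝ) (x u : E) : lnorm f x (-u) = lnorm f x u := by
  simp [lnorm]

theorem lnorm_nonneg (f : E → ℝ) (x u : E) : 0 ≤ lnorm f x u := Real.sqrt_nonneg _

namespace BddSelfConcordant
variable {D : Set E} {f : E → ℝ} (h : BddSelfConcordant D f) {x z : E}
include h

theorem lnorm_mul_le (hx : x ∈ D) (hz : z ∈ D) {r : ℝ} {v : E}
    (hv : D2 f z v v * (1 - r) ^ 2 ≤ D2 f x v v) : lnorm f z v * (1 - r) ≤ lnorm f x v := by
  refine le_of_sq_le_sq ?_ (lnorm_nonneg _ _ _)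
  rwa [mul_pow, h.lnorm_sq hx, h.lnorm_sq hz]

/-- The dual form of `lnorm_mul_le`: the local norm of a representative is the dual norm of the
functional, and `‖a‖_x² = D²f(z)[b, a]` is bounded by Cauchy-Schwarz at `z`. -/
theorem lnorm_rep_mul_le (hx : x ∈ D) (hz : z ∈ D) {r : ℝ} (hr : r ≤ 1)
    (hxz : ∀ v, D2 f z v v * (1 - r) ^ 2 ≤ D2 f x v v) {a b : E} (hab : D2 f x a = D2 f z b) :
    lnorm f x a * (1 - r) ≤ lnorm f z b := by
  have h1 : lnorm f x a ^ 2 ≤ lnorm f z b * lnorm f z a := by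
    rw [h.lnorm_sq hx, hab]; exact (le_abs_self _).trans (h.abs_D2_le hz b a)
  have h2 := h.lnorm_mul_le hx hz (hxz a)
  have h3 := lnorm_nonneg f x a
  have h4 := lnorm_nonneg f z b
  rcases h3.lt_or_eq with h5 | h5
  · refine le_of_mul_le_mul_right ?_ h5
    calc lnorm f x a * (1 - r) * lnorm f x a = lnorm f x a ^ 2 * (1 - r) := by ring
      _ ≤ lnorm f z b * lnorm f z a * (1 - r) := by
          apply mul_le_mul_of_nonneg_right h1; linarith
      _ = lnorm f z b * (lnorm f z a * (1 - r)) := by ring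
      _ ≤ lnorm f z b * lnorm f x a := by gcongr
  · rw [← h5, zero_mul]; exact h4

/-- Points at local distance at most `d < 1` from a point of the domain. -/
theorem D2_compare_of_lnorm_le (hx : x ∈ D) {d : ℝ} (hd : d < 1) (hxz : lnorm f x (z - x) ≤ d) :
    z ∈ D ∧ ∀ v, D2 f z v v * (1 - d) ^ 2 ≤ D2 f x v v ∧ D2 f x v v * (1 - d) ^ 2 ≤ D2 f z v v := by
  have h1 : lnorm f x (z - x) < 1 := hxz.trans_lt hd
  have hz : z ∈ D := by simpa using h.dikin hx h1
  refine ⟨hz, fun v => ?_⟩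
  have h2 := h.D2_compare_of_lnorm_lt_one hx h1 v
  rw [add_sub_cancel] at h2
  have h3 : (1 - d) ^ 2 ≤ (1 - lnorm f x (z - x)) ^ 2 :=
    pow_le_pow_left₀ (by linarith) (by linarith) 2
  exact ⟨(mul_le_mul_of_nonneg_left h3 (h.D2_nonneg hz v)).trans h2.1,
    (mul_le_mul_of_nonneg_left h3 (h.D2_nonneg hx v)).trans h2.2⟩

/-- The residual of one inexact Newton step. Here `x₁`, `x₂` approximate `s₁`, `s₂`, and `w`
represents the difference of the gradients at `s₁` and `s₂` at the point `x₁`. -/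
theorem lnorm_inexact_step_le [FiniteDimensional ℝ E] {s₁ s₂ x₁ x₂ w : E} (hs₁ : s₁ ∈ D)
    (hs₂ : s₂ ∈ D) {d T : ℝ} (hd0 : 0 ≤ d) (hd : d < 1) (h₁ : lnorm f s₁ (x₁ - s₁) ≤ d)
    (h₂ : lnorm f s₂ (x₂ - s₂) ≤ d) (hw : D2 f x₁ w = fderiv ℝ f s₂ - fderiv ℝ f s₁) (hT : 0 ≤ T)
    (hwT : lnorm f x₁ w * (1 + T) ≤ T * (1 - d)) :
    lnorm f x₂ (x₂ - x₁ - w) * (1 - d) ≤ 2 * d + p d * T + T ^ 2 := by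
  obtain ⟨hx₁, hc₁⟩ := h.D2_compare_of_lnorm_le hs₁ hd h₁
  obtain ⟨hx₂, hc₂⟩ := h.D2_compare_of_lnorm_le hs₂ hd h₂
  obtain ⟨w₀, hw₀⟩ := h.exists_D2_eq hs₁ (fderiv ℝ f s₂ - fderiv ℝ f s₁)
  have hd1 : 0 < 1 - d := by linarith
  have hlam0 := lnorm_nonneg f s₁ w₀
  have hlam : lnorm f s₁ w₀ * (1 - d) ≤ lnorm f x₁ w :=
    h.lnorm_rep_mul_le hs₁ hx₁ hd.le (fun v => (hc₁ v).1) (hw₀.trans hw.symm)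
  have hlamT : lnorm f s₁ w₀ * (1 + T) ≤ T := by
    refine le_of_mul_le_mul_right ?_ hd1
    calc _ = lnorm f s₁ w₀ * (1 - d) * (1 + T) := by ring
      _ ≤ lnorm f x₁ w * (1 + T) := by gcongr
      _ ≤ _ := hwT
  have hlam1 : lnorm f s₁ w₀ < 1 := by
    by_contra! hcon
    nlinarith
  have hc := fun v => (h.D2_compare_of_grad hs₁ hs₂ hw₀ hlam1 v).1
  have herr := h.lnorm_newton_error_le hs₁ hs₂ hw₀ hlam1
  have hrep := h.D2_rep_sub_le hs₁ hx₁ hd0 hd hc₁ (hw₀.trans hw.symm) (w₀ - w)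
  set lam := lnorm f s₁ w₀
  have hrep' : lnorm f s₁ (w₀ - w) ≤ (((1 - d) ^ 2)⁻¹ - 1) * lam := by
    rw [← h.lnorm_sq hs₁, abs_of_nonneg (sq_nonneg _)] at hrep
    have hk : 0 ≤ ((1 - d) ^ 2)⁻¹ - 1 :=
      sub_nonneg.2 ((one_le_inv₀ (pow_pos hd1 2)).2 (pow_le_one₀ hd1.le (by linarith)))
    rcases (lnorm_nonneg f s₁ (w₀ - w)).lt_or_eq with h5 | h5
    · refine le_of_mul_le_mul_right ?_ h5
      nlinarith
    · rw [← h5]; positivity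
  -- The first term is measured at `s₂`. The other three are measured at `s₁` and carried to `s₂` at
  -- the cost of a factor `1 / (1 - lam)`.
  have hsplit : x₂ - x₁ - w = (x₂ - s₂) + ((s₁ - x₁) + ((s₂ - s₁ - w₀) + (w₀ - w))) := by abel
  have hneg : lnorm f s₁ (s₁ - x₁) ≤ d := by rw [← lnorm_neg, neg_sub]; exact h₁
  set v := (s₁ - x₁) + ((s₂ - s₁ - w₀) + (w₀ - w))
  have hv : lnorm f s₁ v ≤ d + (lam ^ 2 / (1 - lam) + (((1 - d) ^ 2)⁻¹ - 1) * lam) :=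
    (h.lnorm_add_le hs₁ _ _).trans (add_le_add hneg
      ((h.lnorm_add_le hs₁ _ _).trans (add_le_add herr hrep')))
  have hv2 := h.lnorm_mul_le hs₁ hs₂ (hc v)
  have h6 : lnorm f x₂ (x₂ - x₁ - w) * (1 - d) ≤ d + lnorm f s₂ v := by
    rw [hsplit]
    exact (h.lnorm_mul_le hs₂ hx₂ (hc₂ _).1).trans
      ((h.lnorm_add_le hs₂ _ _).trans (add_le_add_left h₂ _))
  have hl1 : 0 < 1 - lam := by linarith
  -- In this variable `1 / (1 - lam) = 1 + t`, so the transported bound becomes a polynomial in `t`.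
  obtain ⟨t, ht⟩ : ∃ t, t = lam / (1 - lam) := ⟨_, rfl⟩
  have ht0 : 0 ≤ t := by rw [ht]; positivity
  have htT : t ≤ T := by rw [ht, div_le_iff₀ hl1]; linarith
  have h7 : lnorm f s₂ v ≤ d * (1 + t) + t ^ 2 + (((1 - d) ^ 2)⁻¹ - 1) * t := by
    have h8 := (le_div_iff₀ hl1).2 (hv2.trans hv)
    refine h8.trans_eq ?_
    rw [ht]; field_simp; ring
  have hp : d + (((1 - d) ^ 2)⁻¹ - 1) ≤ p d := by
    have : p d - (d + (((1 - d) ^ 2)⁻¹ - 1)) = (d - d ^ 2) * d / (1 - d) ^ 2 := by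
      rw [p]; field_simp; ring
    have h9 : 0 ≤ (d - d ^ 2) * d / (1 - d) ^ 2 := by
      have : 0 ≤ d - d ^ 2 := by nlinarith
      positivity
    linarith
  have hp0 : 0 ≤ p d := by rw [p]; positivity
  have h10 : (d + (((1 - d) ^ 2)⁻¹ - 1)) * t ≤ p d * T := mul_le_mul hp htT ht0 hp0
  have h11 : t ^ 2 ≤ T ^ 2 := pow_le_pow_left₀ ht0 htT 2
  nlinarith

end BddSelfConcordant
end SelfConcordant

/-! ### Coordinates and the separable barrier -/

section

open Matrix

section Coordinates

variable {ι : Type} [Fintype ι] [DecidableEq ι]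

theorem dotProduct_hess_mulVec (f : (ι → ℝ) → ℝ) (x u v : ι → ℝ) :
    u ⬝ᵥ (hess f x *ᵥ v) = D2 f x u v := by
  have hu : ∀ u : ι → ℝ, u = ∑ j, u j • (Pi.single j 1 : ι → ℝ) := fun u => by
    ext k; simp [Finset.sum_apply, Pi.single_apply]
  have h1 : D2 f x u v = ∑ j, ∑ k, u j * (v k * D2 f x (Pi.single j 1) (Pi.single k 1)) := by
    conv_lhs => rw [hu u, hu v]
    simp only [map_sum, map_smul, FunLike.coe_sum, FunLike.coe_smul, Finset.sum_apply,
      Pi.smul_apply, smul_eq_mul, Finset.mul_sum]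
    rw [Finset.sum_comm]
    exact Finset.sum_congr rfl fun j _ => Finset.sum_congr rfl fun k _ => by ring
  rw [h1]
  simp only [dotProduct, mulVec, hess, Matrix.of_apply, iteratedFDeriv_two_apply, Finset.mul_sum]
  refine Finset.sum_congr rfl fun j _ => Finset.sum_congr rfl fun k _ => ?_
  rw [mul_comm (v k)]
  rfl

theorem localNorm_eq_lnorm (f : (ι → ℝ) → ℝ) (x u : ι → ℝ) : localNorm f x u = lnorm f x u := by
  rw [localNorm, lnorm, dotProduct_hess_mulVec]

end Coordinates

theorem IsSelfConcordantBarrier.bddSelfConcordant {ι : Type} [Fintype ι] {S : Set (ι → ℝ)}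
    {f : (ι → ℝ) → ℝ} {ν : ℝ} (h : IsSelfConcordantBarrier S f ν) (hS : Bornology.IsBounded S) :
    BddSelfConcordant (interior S) f where
  isOpen := isOpen_interior
  bounded := hS.subset interior_subset
  convexOn := h.selfConcordant.convexOn
  contDiffOn := h.selfConcordant.contDiffOn
  isClosed_sublevel := h.selfConcordant.isClosed_sublevel
  third_le x hx u := by
    have := h.selfConcordant.third_le x hx u
    rwa [ContDiffAt.iteratedFDeriv_three_diag
      (h.selfConcordant.contDiffOn.contDiffAt (isOpen_interior.mem_nhds hx)),
      iteratedFDeriv_two_diag] at this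

namespace Problem

variable {M : ℕ} {n : Fin M → ℕ} {m : ℕ} {P : Problem M n m}

/-- The projection to the `i`-th block as a continuous linear map. -/
def blockL (n : Fin M → ℕ) (i : Fin M) : (Idx n → ℝ) →L[ℝ] (Fin (n i) → ℝ) :=
  ContinuousLinearMap.pi fun j => ContinuousLinearMap.proj (⟨i, j⟩ : Idx n)

theorem blockL_apply (x : Idx n → ℝ) (i : Fin M) : blockL n i x = block x i := rfl

theorem Standing.bddSelfConcordant_block (hP : P.Standing) (i : Fin M) :
    BddSelfConcordant (interior (P.X i)) (P.F i) :=
  (hP.barrier i).bddSelfConcordant (hP.bounded i)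

theorem bigF_eq (P : Problem M n m) : P.bigF = fun x => ∑ i, P.F i (blockL n i x) := rfl

theorem isOpen_inDom (P : Problem M n m) : IsOpen {x | P.InDom x} := by
  have : {x | P.InDom x} = ⋂ i, blockL n i ⁻¹' interior (P.X i) := by
    ext x; simp only [mem_iInter]; rfl
  rw [this]
  exact isOpen_iInter_of_finite fun i => isOpen_interior.preimage (blockL n i).continuous

theorem Standing.contDiffOn_bigF (hP : P.Standing) : ContDiffOn ℝ 3 P.bigF {x | P.InDom x} := by
  rw [bigF_eq]
  refine ContDiffOn.sum fun i _ => ?_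
  exact (hP.bddSelfConcordant_block i).contDiffOn.comp (blockL n i).contDiff.contDiffOn
    fun x hx => hx i

theorem Standing.contDiffAt_bigF (hP : P.Standing) {x : Idx n → ℝ} (hx : P.InDom x) :
    ContDiffAt ℝ 3 P.bigF x :=
  hP.contDiffOn_bigF.contDiffAt (P.isOpen_inDom.mem_nhds hx)

theorem Standing.fderiv_bigF (hP : P.Standing) {x : Idx n → ℝ} (hx : P.InDom x) (v : Idx n → ℝ) :
    fderiv ℝ P.bigF x v = ∑ i, fderiv ℝ (P.F i) (block x i) (block v i) := by
  have h1 : HasFDerivAt P.bigF (∑ i, (fderiv ℝ (P.F i) (blockL n i x)).comp (blockL n i)) x := by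
    rw [bigF_eq]
    refine HasFDerivAt.fun_sum fun i _ => ?_
    exact (ContDiffAt.hasFDerivAt_one ((hP.bddSelfConcordant_block i).contDiffAt (hx i))).comp x
      (blockL n i).hasFDerivAt
  rw [h1.fderiv, _root_.sum_apply]
  rfl

theorem eventually_line_inDom {x : Idx n → ℝ} (hx : P.InDom x) (u : Idx n → ℝ) :
    ∀ᶠ s : ℝ in 𝓝 0, P.InDom (x + s • u) := by
  have hc : Continuous fun s : ℝ => x + s • u := by fun_prop
  exact (P.isOpen_inDom.preimage hc).mem_nhds (by simpa using hx)

theorem Standing.D2_bigF (hP : P.Standing) {x : Idx n → ℝ} (hx : P.InDom x) (u v : Idx n → ℝ) :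
    D2 P.bigF x u v = ∑ i, D2 (P.F i) (block x i) (block u i) (block v i) := by
  have h1 := ContDiffAt.hasDerivAt_line_fderiv (x := x) u v 0 (f := P.bigF)
    (by simpa using hP.contDiffAt_bigF hx)
  have h2 : HasDerivAt (fun s : ℝ => ∑ i, fderiv ℝ (P.F i) (block x i + s • block u i) (block v i))
      (∑ i, D2 (P.F i) (block x i + (0 : ℝ) • block u i) (block u i) (block v i)) 0 :=
    HasDerivAt.fun_sum fun i _ => ContDiffAt.hasDerivAt_line_fderiv _ _ _
      (by simpa using (hP.bddSelfConcordant_block i).contDiffAt (hx i))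
  have h3 := h2.congr_of_eventuallyEq (f₁ := fun s : ℝ => fderiv ℝ P.bigF (x + s • u) v) (by
    filter_upwards [eventually_line_inDom hx u] with s hs using hP.fderiv_bigF hs v)
  simpa using h1.unique h3

theorem Standing.D3_bigF (hP : P.Standing) {x : Idx n → ℝ} (hx : P.InDom x)
    (u v w : Idx n → ℝ) :
    D3 P.bigF x u v w = ∑ i, D3 (P.F i) (block x i) (block u i) (block v i) (block w i) := by
  have h1 := ContDiffAt.hasDerivAt_line_D2 (x := x) u v w 0 (f := P.bigF)
    (by simpa using hP.contDiffAt_bigF hx)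
  have h2 : HasDerivAt
      (fun s : ℝ => ∑ i, D2 (P.F i) (block x i + s • block u i) (block v i) (block w i))
      (∑ i, D3 (P.F i) (block x i + (0 : ℝ) • block u i) (block u i) (block v i) (block w i)) 0 :=
    HasDerivAt.fun_sum fun i _ => ContDiffAt.hasDerivAt_line_D2 _ _ _ _
      (by simpa using (hP.bddSelfConcordant_block i).contDiffAt (hx i))
  have h3 := h2.congr_of_eventuallyEq (f₁ := fun s : ℝ => D2 P.bigF (x + s • u) v w) (by
    filter_upwards [eventually_line_inDom hx u] with s hs using hP.D2_bigF hs v w)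
  simpa using h1.unique h3

theorem Standing.convexOn_bigF (hP : P.Standing) : ConvexOn ℝ {x | P.InDom x} P.bigF := by
  have hconv : Convex ℝ {x | P.InDom x} := fun x hx y hy a b ha hb hab i =>
    (hP.bddSelfConcordant_block i).convexOn.1 (hx i) (hy i) ha hb hab
  refine ⟨hconv, fun x hx y hy a b ha hb hab => ?_⟩
  simp only [bigF, smul_eq_mul, Finset.mul_sum, ← Finset.sum_add_distrib]
  exact Finset.sum_le_sum fun i _ =>
    (hP.bddSelfConcordant_block i).convexOn.2 (hx i) (hy i) ha hb hab

/-- Each `Fᵢ` is bounded below by some `lᵢ`, so `F ≤ a` forces every `Fᵢ` below a fixed level. The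
sublevel set therefore lies in the closed set `K`, on which `F` is continuous. -/
theorem Standing.isClosed_sublevel_bigF (hP : P.Standing) (a : ℝ) :
    IsClosed {x | x ∈ {x | P.InDom x} ∧ P.bigF x ≤ a} := by
  have hlow : ∀ i, ∃ l, ∀ x ∈ interior (P.X i), l ≤ P.F i x := fun i => by
    obtain ⟨x, -, hmin⟩ := (hP.bddSelfConcordant_block i).exists_isMinOn_sub
      (hP.interior_nonempty i) 0
    exact ⟨P.F i x, fun y hy => by simpa using hmin hy⟩
  choose l hl using hlow
  set K : Set (Idx n → ℝ) := ⋂ i, blockL n i ⁻¹'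
    {x | x ∈ interior (P.X i) ∧ P.F i x ≤ a - ∑ j, l j + l i} with hK
  have hKc : IsClosed K := isClosed_iInter fun i =>
    ((hP.bddSelfConcordant_block i).isClosed_sublevel _).preimage (blockL n i).continuous
  have hKD : K ⊆ {x | P.InDom x} := fun x hx i => (mem_iInter.1 hx i).1
  have hcl := (hP.contDiffOn_bigF.continuousOn.mono hKD).preimage_isClosed_of_isClosed hKc
    (isClosed_Iic (a := a))
  suffices heq : {x | x ∈ {x | P.InDom x} ∧ P.bigF x ≤ a} = K ∩ P.bigF ⁻¹' Iic a by rwa [heq]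
  ext x
  refine ⟨fun hx => ⟨mem_iInter.2 fun i => ⟨hx.1 i, ?_⟩, hx.2⟩, fun hx => ⟨hKD hx.1, hx.2⟩⟩
  have h1 : ∑ j, l j - l i ≤ P.bigF x - P.F i (block x i) := by
    rw [bigF, ← Finset.sum_erase_eq_sub (Finset.mem_univ i),
      ← Finset.sum_erase_eq_sub (Finset.mem_univ i)]
    exact Finset.sum_le_sum fun j _ => hl j _ (hx.1 j)
  have h2 : P.bigF x ≤ a := hx.2
  rw [blockL_apply]
  linarith

theorem Standing.isBounded_inDom (hP : P.Standing) : Bornology.IsBounded {x | P.InDom x} := by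
  choose R hR using fun i => (hP.bounded i).exists_norm_le
  refine isBounded_iff_forall_norm_le.2 ⟨∑ i, |R i|, fun x hx => ?_⟩
  refine (pi_norm_le_iff_of_nonneg (Finset.sum_nonneg fun i _ => abs_nonneg _)).2 fun k => ?_
  calc ‖x k‖ = ‖block x k.1 k.2‖ := rfl
    _ ≤ ‖block x k.1‖ := norm_le_pi_norm _ _
    _ ≤ R k.1 := hR _ _ (interior_subset (hx k.1))
    _ ≤ |R k.1| := le_abs_self _
    _ ≤ _ := Finset.single_le_sum (f := fun i => |R i|) (fun i _ => abs_nonneg _)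
      (Finset.mem_univ k.1)

theorem Standing.bddSelfConcordant (hP : P.Standing) :
    BddSelfConcordant {x | P.InDom x} P.bigF where
  isOpen := P.isOpen_inDom
  bounded := hP.isBounded_inDom
  convexOn := hP.convexOn_bigF
  contDiffOn := hP.contDiffOn_bigF
  isClosed_sublevel := hP.isClosed_sublevel_bigF
  third_le x hx u := by
    rw [hP.D3_bigF hx, hP.D2_bigF hx]
    set q : Fin M → ℝ := fun i => D2 (P.F i) (block x i) (block u i) (block u i) with hq
    have hq0 : ∀ i, 0 ≤ q i := fun i => (hP.bddSelfConcordant_block i).D2_nonneg (hx i) _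
    have hS : 0 ≤ ∑ i, q i := Finset.sum_nonneg fun i _ => hq0 i
    calc _ ≤ ∑ i, |D3 (P.F i) (block x i) (block u i) (block u i) (block u i)| :=
          Finset.abs_sum_le_sum_abs _ _
      -- Separability costs no constant, because `∑ qᵢ^(3/2) ≤ (∑ qᵢ)^(3/2)`.
      _ ≤ ∑ i, 2 * (q i * Real.sqrt (∑ j, q j)) := Finset.sum_le_sum fun i _ => by
          refine ((hP.bddSelfConcordant_block i).third_le _ (hx i) _).trans ?_
          have h1 : Real.sqrt (q i) ^ 3 = q i * Real.sqrt (q i) := by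
            rw [pow_succ, Real.sq_sqrt (hq0 i)]
          change 2 * Real.sqrt (q i) ^ 3 ≤ _
          rw [h1]
          have h2 : Real.sqrt (q i) ≤ Real.sqrt (∑ j, q j) :=
            Real.sqrt_le_sqrt (Finset.single_le_sum (fun j _ => hq0 j) (Finset.mem_univ i))
          have := hq0 i
          gcongr
      _ = 2 * Real.sqrt (∑ i, q i) ^ 3 := by
          rw [← Finset.mul_sum, ← Finset.sum_mul, pow_succ, Real.sq_sqrt hS]

/-! ### Primal subproblems and the Newton system in the dual -/

theorem dotProduct_bigA_mulVec (P : Problem M n m) (y : Fin m → ℝ) (v : Idx n → ℝ) :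
    y ⬝ᵥ (P.bigA *ᵥ v) = ∑ i, y ⬝ᵥ (P.A i *ᵥ block v i) := by
  have : P.bigA *ᵥ v = ∑ i, P.A i *ᵥ block v i := by
    ext r
    simp only [mulVec, dotProduct, Finset.sum_apply, bigA, Matrix.of_apply]
    rw [Fintype.sum_sigma]
    rfl
  rw [this, dotProduct_sum]

theorem Standing.xstarBlock_spec (hP : P.Standing) (i : Fin M) (y : Fin m → ℝ) {t : ℝ}
    (ht : 0 < t) : P.xstarBlock i y t ∈ interior (P.X i) ∧
      ∀ v, t * fderiv ℝ (P.F i) (P.xstarBlock i y t) v = P.c i ⬝ᵥ v + y ⬝ᵥ (P.A i *ᵥ v) := by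
  have h := hP.bddSelfConcordant_block i
  obtain ⟨ℓ, hℓ⟩ : ∃ ℓ : (Fin (n i) → ℝ) →L[ℝ] ℝ, ∀ v, ℓ v = P.c i ⬝ᵥ v + y ⬝ᵥ (P.A i *ᵥ v) := by
    refine ⟨LinearMap.toContinuousLinearMap
      { toFun := fun v => P.c i ⬝ᵥ v + y ⬝ᵥ (P.A i *ᵥ v)
        map_add' := fun u v => by simp only [dotProduct_add, mulVec_add]; ring
        map_smul' := fun a v => by
          simp only [dotProduct_smul, mulVec_smul, smul_eq_mul, RingHom.id_apply]; ring }, ?_⟩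
    intro v; rfl
  have hobj : P.subObjective i y t = fun x => ℓ x - t * P.F i x := by
    funext x; rw [subObjective, hℓ]
  have hex : ∃ x, x ∈ interior (P.X i) ∧ IsMaxOn (P.subObjective i y t) (interior (P.X i)) x := by
    obtain ⟨x, hx, hmin⟩ := h.exists_isMinOn_sub (hP.interior_nonempty i) (t⁻¹ • ℓ)
    refine ⟨x, hx, fun z hz => ?_⟩
    have h1 : P.F i x - t⁻¹ * ℓ x ≤ P.F i z - t⁻¹ * ℓ z := hmin hz
    have h2 := mul_le_mul_of_nonneg_left h1 ht.le
    have e : ∀ z, t * (P.F i z - t⁻¹ * ℓ z) = t * P.F i z - ℓ z := fun z => by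
      field_simp
    rw [e, e] at h2
    simp only [hobj, mem_ofPred_eq]
    linarith
  have hspec := Classical.epsilon_spec hex
  change P.xstarBlock i y t ∈ interior (P.X i) ∧
    IsMaxOn (P.subObjective i y t) (interior (P.X i)) (P.xstarBlock i y t) at hspec
  refine ⟨hspec.1, fun v => ?_⟩
  have hd : HasFDerivAt (P.subObjective i y t) (ℓ - t • fderiv ℝ (P.F i) (P.xstarBlock i y t))
      (P.xstarBlock i y t) := by
    rw [hobj]
    exact ℓ.hasFDerivAt.sub ((ContDiffAt.hasFDerivAt_one (h.contDiffAt hspec.1)).const_mul t)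
  have h0 := (hspec.2.isLocalMax (isOpen_interior.mem_nhds hspec.1)).hasFDerivAt_eq_zero hd
  have h1 := congrArg (fun l : (Fin (n i) → ℝ) →L[ℝ] ℝ => l v) h0
  simp only [_root_.sub_apply, _root_.smul_apply, smul_eq_mul, _root_.zero_apply] at h1
  rw [← hℓ]; linarith

theorem Standing.inDom_xstar (hP : P.Standing) (y : Fin m → ℝ) {t : ℝ} (ht : 0 < t) :
    P.InDom (P.xstar y t) := fun i => (hP.xstarBlock_spec i y ht).1

theorem Standing.fderiv_xstar (hP : P.Standing) (y : Fin m → ℝ) {t : ℝ} (ht : 0 < t)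
    (v : Idx n → ℝ) : t * fderiv ℝ P.bigF (P.xstar y t) v =
      ∑ i, P.c i ⬝ᵥ block v i + y ⬝ᵥ (P.bigA *ᵥ v) := by
  rw [hP.fderiv_bigF (hP.inDom_xstar y ht), dotProduct_bigA_mulVec, ← Finset.sum_add_distrib,
    Finset.mul_sum]
  exact Finset.sum_congr rfl fun i _ => (hP.xstarBlock_spec i y ht).2 _

/-- The matrix `A ∇²F(x)⁻¹ Aᵀ`. -/
noncomputable def schur (P : Problem M n m) (x : Idx n → ℝ) : Matrix (Fin m) (Fin m) ℝ :=
  P.bigA * (hess P.bigF x)⁻¹ * P.bigAᵀ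

theorem Standing.isUnit_hess (hP : P.Standing) {x : Idx n → ℝ} (hx : P.InDom x) :
    IsUnit (hess P.bigF x) := by
  rw [← Matrix.mulVec_injective_iff_isUnit]
  intro u v huv
  by_contra hne
  have := hP.bddSelfConcordant.D2_pos hx (sub_ne_zero.2 hne)
  rw [← dotProduct_hess_mulVec, mulVec_sub, huv] at this
  simp at this

theorem Standing.hess_mulVec_inv (hP : P.Standing) {x : Idx n → ℝ} (hx : P.InDom x)
    (u : Idx n → ℝ) : hess P.bigF x *ᵥ ((hess P.bigF x)⁻¹ *ᵥ u) = u := by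
  rw [mulVec_mulVec, Matrix.mul_nonsing_inv _ ((Matrix.isUnit_iff_isUnit_det _).1 (hP.isUnit_hess hx)),
    one_mulVec]

theorem Standing.bigA_vecMul_injective (hP : P.Standing) :
    Function.Injective fun s : Fin m → ℝ => s ᵥ* P.bigA := by
  rw [Matrix.vecMul_injective_iff, linearIndependent_iff_card_eq_finrank_span]
  have := hP.fullRowRank
  rw [Matrix.rank_eq_finrank_span_row] at this
  rw [Fintype.card_fin]
  exact this.symm

/-- If `A H⁻¹ Aᵀ s = 0`, then `r = H⁻¹ Aᵀ s` satisfies `A r = 0`, so `rᵀ H r = (A r)ᵀ s = 0`. Hence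
`r = 0` and `Aᵀ s = 0`, and full row rank gives `s = 0`. -/
theorem Standing.isUnit_schur (hP : P.Standing) {x : Idx n → ℝ} (hx : P.InDom x) :
    IsUnit (P.schur x) := by
  rw [← Matrix.mulVec_injective_iff_isUnit]
  suffices H : ∀ s, P.schur x *ᵥ s = 0 → s = 0 by
    intro u v huv
    exact sub_eq_zero.1 (H _ (by rw [mulVec_sub]; exact sub_eq_zero.2 huv))
  intro s hs
  set r := (hess P.bigF x)⁻¹ *ᵥ (P.bigAᵀ *ᵥ s) with hr
  have hAr : P.bigA *ᵥ r = 0 := by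
    rw [← hs, schur, hr, mulVec_mulVec, mulVec_mulVec, Matrix.mul_assoc]
  have hHr : hess P.bigF x *ᵥ r = P.bigAᵀ *ᵥ s := hP.hess_mulVec_inv hx _
  have hr0 : r = 0 := by
    by_contra hne
    have := hP.bddSelfConcordant.D2_pos hx hne
    rw [← dotProduct_hess_mulVec, hHr, mulVec_transpose, dotProduct_comm, ← dotProduct_mulVec,
      hAr] at this
    simp at this
  rw [hr0, mulVec_zero, mulVec_transpose] at hHr
  exact hP.bigA_vecMul_injective (by simp [← hHr])

/-- The element of least local norm among the solutions of `A w = g`. -/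
theorem Standing.exists_least_norm_solution (hP : P.Standing) {x : Idx n → ℝ} (hx : P.InDom x)
    (g : Fin m → ℝ) : ∃ w, P.bigA *ᵥ w = g ∧
      (∀ v, D2 P.bigF x w v = ((P.schur x)⁻¹ *ᵥ g) ⬝ᵥ (P.bigA *ᵥ v)) ∧
      lnorm P.bigF x w = Real.sqrt (g ⬝ᵥ ((P.schur x)⁻¹ *ᵥ g)) ∧
      ∀ z, P.bigA *ᵥ z = g → lnorm P.bigF x w ≤ lnorm P.bigF x z := by
  have h := hP.bddSelfConcordant
  set σ := (P.schur x)⁻¹ *ᵥ g with hσ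
  set w := (hess P.bigF x)⁻¹ *ᵥ (P.bigAᵀ *ᵥ σ) with hw
  have hAw : P.bigA *ᵥ w = g := by
    have : P.schur x *ᵥ σ = g := by
      rw [hσ, mulVec_mulVec, Matrix.mul_nonsing_inv _
        ((Matrix.isUnit_iff_isUnit_det _).1 (hP.isUnit_schur hx)), one_mulVec]
    rw [← this, schur, hw, mulVec_mulVec, mulVec_mulVec, Matrix.mul_assoc]
  have hD : ∀ v, D2 P.bigF x w v = σ ⬝ᵥ (P.bigA *ᵥ v) := fun v => by
    rw [h.D2_symm hx, ← dotProduct_hess_mulVec, hw, hP.hess_mulVec_inv hx, mulVec_transpose,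
      dotProduct_comm, dotProduct_mulVec]
  refine ⟨w, hAw, hD, ?_, fun z hz => ?_⟩
  · rw [lnorm, hD, hAw, dotProduct_comm]
  · have h1 : lnorm P.bigF x w ^ 2 = D2 P.bigF x w z := by
      rw [h.lnorm_sq hx, hD, hD, hAw, hz]
    have h2 := (le_abs_self _).trans (h.abs_D2_le hx w z)
    rw [← h1] at h2
    rcases (lnorm_nonneg P.bigF x w).lt_or_eq with h3 | h3
    · nlinarith
    · rw [← h3]; exact lnorm_nonneg _ _ _

theorem Standing.inv_smul_schur (hP : P.Standing) {x : Idx n → ℝ} (hx : P.InDom x) {k : ℝ}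
    (hk : k ≠ 0) : (k • P.schur x)⁻¹ = k⁻¹ • (P.schur x)⁻¹ :=
  Matrix.inv_smul' (P.schur x) (Units.mk0 k hk)
    ((Matrix.isUnit_iff_isUnit_det _).1 (hP.isUnit_schur hx))

theorem Standing.inexDecrement_eq (hP : P.Standing) {xb : (Fin m → ℝ) → ℝ → Idx n → ℝ}
    {y : Fin m → ℝ} {t : ℝ} (ht : 0 < t) (hx : P.InDom (xb y t)) : P.inexDecrement xb y t =
      Real.sqrt (P.inexGrad xb y t ⬝ᵥ ((P.schur (xb y t))⁻¹ *ᵥ P.inexGrad xb y t)) := by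
  rw [inexDecrement, inexHess, smul_smul]
  change Real.sqrt (_ ⬝ᵥ (((1 / t * (1 / t)) • P.schur (xb y t))⁻¹ *ᵥ _)) = _
  rw [hP.inv_smul_schur hx (by positivity), smul_mulVec, mulVec_smul, smul_dotProduct,
    dotProduct_smul, dotProduct_smul]
  congr 1
  simp only [smul_eq_mul]
  field_simp

theorem Standing.newtonStep_sub (hP : P.Standing) {xb : (Fin m → ℝ) → ℝ → Idx n → ℝ}
    {y : Fin m → ℝ} {t : ℝ} (ht : 0 < t) (hx : P.InDom (xb y t)) :
    P.newtonStep xb y t = y - t • ((P.schur (xb y t))⁻¹ *ᵥ P.inexGrad xb y t) := by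
  rw [newtonStep, inexHess]
  change y - ((1 / t) • P.schur (xb y t))⁻¹ *ᵥ _ = _
  rw [hP.inv_smul_schur hx (by positivity), smul_mulVec, one_div, inv_inv]

/-- One inexact full Newton step at the decreased parameter. -/
theorem Standing.inexDecrement_newtonStep_le (hP : P.Standing)
    {xb : (Fin m → ℝ) → ℝ → Idx n → ℝ} {y yp : Fin m → ℝ} {t tp d β T δ : ℝ} (ht : 0 < t)
    (htp : 0 < tp) (hyp : yp = P.newtonStep xb y tp) (hx₀ : P.InDom (xb y t))
    (hd0 : 0 ≤ d) (hd : d < 1) (hT : 0 ≤ T) (hδ : δ < 1)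
    (hβT : (β + δ) * (1 + T) ≤ T * (1 - d) * (1 - δ))
    (h₂ : P.err xb yp tp ≤ d) (h₁ : P.err xb y tp ≤ d)
    (hΔ : localNorm P.bigF (xb y t) (xb y tp - xb y t) ≤ δ) (hβ : P.inexDecrement xb y t ≤ β) :
    P.inexDecrement xb yp tp * (1 - d) ≤ 2 * d + p d * T + T ^ 2 := by
  have h := hP.bddSelfConcordant
  rw [err, localNorm_eq_lnorm] at h₁ h₂
  rw [localNorm_eq_lnorm] at hΔ
  have hs₁ := hP.inDom_xstar y htp
  have hs₂ := hP.inDom_xstar yp htp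
  have hx₁ : P.InDom (xb y tp) := (h.D2_compare_of_lnorm_le hs₁ hd h₁).1
  have hx₂ : P.InDom (xb yp tp) := (h.D2_compare_of_lnorm_le hs₂ hd h₂).1
  obtain ⟨w₀, hw₀A, -, hw₀n, -⟩ := hP.exists_least_norm_solution hx₀ (P.inexGrad xb y t)
  obtain ⟨w₁, hw₁A, hw₁D, -, hw₁min⟩ :=
    hP.exists_least_norm_solution hx₁ (P.inexGrad xb y tp)
  obtain ⟨w₂, -, -, hw₂n, hw₂min⟩ := hP.exists_least_norm_solution hx₂ (P.inexGrad xb yp tp)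
  rw [← hP.inexDecrement_eq ht hx₀] at hw₀n
  rw [← hP.inexDecrement_eq htp hx₂] at hw₂n
  have hc := (h.D2_compare_of_lnorm_le hx₀ hδ hΔ).2
  -- Adding the change of `x̄` to the least-norm solution at `(y,t)` gives a competitor at `(y,t₊)`;
  -- moving from one local norm to the other costs the factor `1 - δ`.
  have hdec : lnorm P.bigF (xb y tp) w₁ * (1 - δ) ≤ β + δ := by
    have h3 := hw₁min (w₀ + (xb y tp - xb y t)) (by
      rw [mulVec_add, mulVec_sub, hw₀A, inexGrad, inexGrad]; abel)
    calc _ ≤ lnorm P.bigF (xb y tp) (w₀ + (xb y tp - xb y t)) * (1 - δ) := by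
          apply mul_le_mul_of_nonneg_right h3; linarith
      _ ≤ lnorm P.bigF (xb y t) (w₀ + (xb y tp - xb y t)) := h.lnorm_mul_le hx₀ hx₁ (hc _).1
      _ ≤ _ := (h.lnorm_add_le hx₀ _ _).trans (add_le_add (hw₀n.trans_le hβ) hΔ)
  have hdecT : lnorm P.bigF (xb y tp) w₁ * (1 + T) ≤ T * (1 - d) := by
    refine le_of_mul_le_mul_right ?_ (sub_pos.2 hδ)
    calc _ = lnorm P.bigF (xb y tp) w₁ * (1 - δ) * (1 + T) := by ring
      _ ≤ (β + δ) * (1 + T) := by gcongr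
      _ ≤ _ := hβT
  -- Subtracting the two optimality conditions eliminates `c` and leaves `Aᵀ (y₊ - y) / t₊`, which
  -- the Newton step makes equal to `-∇²F(x₁) w₁`.
  have hw : D2 P.bigF (xb y tp) (-w₁) =
      fderiv ℝ P.bigF (P.xstar yp tp) - fderiv ℝ P.bigF (P.xstar y tp) := by
    ext v
    have e1 := hP.fderiv_xstar yp htp v
    have e2 := hP.fderiv_xstar y htp v
    have e3 := hw₁D v
    have e0 : yp ⬝ᵥ (P.bigA *ᵥ v) =
        y ⬝ᵥ (P.bigA *ᵥ v) - tp * D2 P.bigF (xb y tp) w₁ v := by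
      rw [hyp, hP.newtonStep_sub htp hx₁, sub_dotProduct, smul_dotProduct, ← e3, smul_eq_mul]
    rw [e0] at e1
    rw [map_neg, _root_.neg_apply, _root_.sub_apply]
    refine mul_left_cancel₀ htp.ne' ?_
    linarith
  have key := h.lnorm_inexact_step_le hs₁ hs₂ hd0 hd h₁ h₂ hw hT (by rwa [lnorm_neg])
  refine le_trans (mul_le_mul_of_nonneg_right ?_ (by linarith)) key
  rw [← hw₂n]
  -- `A x₁ - A w₁ = b`, so `x₂ - x₁ + w₁` solves the new system `A z = A x₂ - b`.
  refine hw₂min _ ?_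
  rw [mulVec_sub, mulVec_sub, mulVec_neg, hw₁A, inexGrad, inexGrad]
  abel

end Problem
end

/-! ### The discriminant, the roots of the cubic, and the parameters -/

section Scalars

open Polynomial

/-- The discriminant multiplied by `(1 - δ̄)⁶`. -/
noncomputable def discNumerator : ℝ[X] :=
  C 5 - C 176 * X + C 1720 * X ^ 2 - C 8458 * X ^ 3 + C 25318 * X ^ 4 - C 50842 * X ^ 5
    + C 72647 * X ^ 6 - C 76190 * X ^ 7 + C 59147 * X ^ 8 - C 33692 * X ^ 9 + C 13775 * X ^ 10
    - C 3902 * X ^ 11 + C 725 * X ^ 12 - C 80 * X ^ 13 + C 4 * X ^ 14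

theorem eval_discNumerator (x : ℝ) : discNumerator.eval x =
    5 - 176 * x + 1720 * x ^ 2 - 8458 * x ^ 3 + 25318 * x ^ 4 - 50842 * x ^ 5
    + 72647 * x ^ 6 - 76190 * x ^ 7 + 59147 * x ^ 8 - 33692 * x ^ 9 + 13775 * x ^ 10
    - 3902 * x ^ 11 + 725 * x ^ 12 - 80 * x ^ 13 + 4 * x ^ 14 := by
  simp [discNumerator]

theorem cubicDisc_mul {d : ℝ} (hd : d < 1) :
    cubicDisc d * (1 - d) ^ 6 = discNumerator.eval d := by
  have hne : 1 - d ≠ 0 := by linarith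
  have h1 : c₁ d = (1 - 3 * d + d ^ 4) / (1 - d) := by
    rw [c₁, p]; field_simp; ring
  have h2 : c₂ d = (-3 + 11 * d - 11 * d ^ 2 + 6 * d ^ 3 - 2 * d ^ 4) / (1 - d) ^ 2 := by
    rw [c₂, p]; field_simp; ring
  rw [cubicDisc, h1, h2, c₀, c₃, eval_discNumerator]
  field_simp
  ring

/-- Pairing each even power in the derivative with the next odd one leaves linear factors that are
negative below `1/20`; the tightest is `-176 + 3440 x`. -/
theorem strictAntiOn_discNumerator :
    StrictAntiOn (fun x => discNumerator.eval x) (Icc 0 (1 / 20)) := by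
  refine strictAntiOn_of_deriv_neg (convex_Icc _ _) discNumerator.continuous.continuousOn
    fun x hx => ?_
  rw [interior_Icc] at hx
  obtain ⟨h0, h1⟩ := hx
  rw [Polynomial.deriv]
  have : discNumerator.derivative.eval x =
      (-176 + 3440 * x) + (-25374 + 101272 * x) * x ^ 2 + (-254210 + 435882 * x) * x ^ 4
      + (-533330 + 473176 * x) * x ^ 6 + (-303228 + 137750 * x) * x ^ 8
      + (-42922 + 8700 * x) * x ^ 10 + (-1040 + 56 * x) * x ^ 12 := by
    simp [discNumerator]; ring
  rw [this]
  have e : ∀ k : ℕ, 0 ≤ x ^ k := fun k => by positivity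
  have t1 := mul_nonpos_of_nonpos_of_nonneg (by linarith : -25374 + 101272 * x ≤ 0) (e 2)
  have t2 := mul_nonpos_of_nonpos_of_nonneg (by linarith : -254210 + 435882 * x ≤ 0) (e 4)
  have t3 := mul_nonpos_of_nonpos_of_nonneg (by linarith : -533330 + 473176 * x ≤ 0) (e 6)
  have t4 := mul_nonpos_of_nonpos_of_nonneg (by linarith : -303228 + 137750 * x ≤ 0) (e 8)
  have t5 := mul_nonpos_of_nonpos_of_nonneg (by linarith : -42922 + 8700 * x ≤ 0) (e 10)
  have t6 := mul_nonpos_of_nonpos_of_nonneg (by linarith : -1040 + 56 * x ≤ 0) (e 12)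
  linarith

theorem δmax_spec : |δmax - 0.0432863855| ≤ 5 / 10 ^ 11 ∧
    ∀ d, 0 ≤ d → d ≤ δmax → 0 ≤ cubicDisc d ∧ (d < δmax → 0 < cubicDisc d) := by
  -- The two ends are the claimed value minus and plus `5 * 10⁻¹¹`. A sign change between them, with
  -- strict monotonicity on `[0, 1/20]`, isolates the smallest positive zero.
  have hab : (0.04328638545 : ℝ) ≤ 0.04328638555 := by norm_num
  have ha : 0 ≤ discNumerator.eval (0.04328638545 : ℝ) := by
    rw [eval_discNumerator]; norm_num
  have hb : discNumerator.eval (0.04328638555 : ℝ) ≤ 0 := by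
    rw [eval_discNumerator]; norm_num
  obtain ⟨r, hr, hr0⟩ := intermediate_value_Icc' hab discNumerator.continuous.continuousOn ⟨hb, ha⟩
  have hr1 : 0 < r := by have := hr.1; norm_num at this; linarith
  have hr2 : r ≤ 1 / 20 := by have := hr.2; norm_num at this; linarith
  have hanti := strictAntiOn_discNumerator
  have hpos : ∀ d : ℝ, d < 1 → 0 < (1 - d) ^ 6 := fun d hd => pow_pos (by linarith) 6
  have hleast : IsLeast {δb : ℝ | 0 < δb ∧ cubicDisc δb = 0} r := by
    refine ⟨⟨hr1, ?_⟩, fun s hs => ?_⟩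
    · have := cubicDisc_mul (d := r) (by linarith)
      change discNumerator.eval r = 0 at hr0
      rw [hr0] at this
      exact (mul_eq_zero.1 this).resolve_right (hpos r (by linarith)).ne'
    · by_contra! hsr
      have h1 := hanti (a := s) (b := r) ⟨hs.1.le, by linarith⟩ ⟨hr1.le, hr2⟩ hsr
      have h2 := cubicDisc_mul (d := s) (by linarith)
      rw [hs.2, zero_mul] at h2
      simp only [hr0, ← h2] at h1
      exact lt_irrefl _ h1
  have hδ : δmax = r := hleast.csInf_eq
  rw [hδ]
  refine ⟨?_, fun d hd0 hdr => ?_⟩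
  · have h1 := hr.1
    have h2 := hr.2
    rw [abs_le]
    norm_num at h1 h2 ⊢
    constructor <;> linarith
  · have hlt : d < r → 0 < cubicDisc d := fun hlt => by
      have h1 := hanti (a := d) (b := r) ⟨hd0, by linarith⟩ ⟨hr1.le, hr2⟩ hlt
      simp only [hr0, ← cubicDisc_mul (d := d) (by linarith)] at h1
      exact pos_of_mul_pos_left h1 (hpos d (by linarith)).le
    refine ⟨?_, hlt⟩
    rcases hdr.lt_or_eq with h | h
    · exact (hlt h).le
    · rw [h, hleast.1.2]

/-- The bound `433/10000` is a rational number slightly above `δmax`; the linear estimates suffice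
for the sign checks on the cubic. -/
theorem p_bounds {d : ℝ} (hd0 : 0 ≤ d) (hd : d ≤ 433 / 10000) : 3 * d ≤ p d ∧ p d ≤ 16 / 5 * d := by
  have hp : 0 < (1 - d) ^ 2 := pow_pos (by linarith) 2
  have h : p d = d * (3 - 2 * d) / (1 - d) ^ 2 := by
    have : 1 - d ≠ 0 := by linarith
    rw [p]; field_simp; ring
  rw [h, le_div_iff₀ hp, div_le_iff₀ hp]
  constructor <;> nlinarith [mul_nonneg hd0 hd0, mul_nonneg (mul_nonneg hd0 hd0) hd0,
    mul_nonneg hd0 (sub_nonneg.2 hd)]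

theorem eval_cubic (d x : ℝ) :
    (cubic d).eval x = c₀ d + c₁ d * x + c₂ d * x ^ 2 + c₃ d * x ^ 3 := by
  simp [cubic]

theorem cubic_roots {d : ℝ} (hd0 : 0 ≤ d) (hd : d ≤ 433 / 10000) (hdisc : 0 ≤ cubicDisc d) :
    ∃ β₁ β₂ β₃ : ℝ, (cubic d).roots = {β₁, β₂, β₃} ∧
      (∀ x, (cubic d).eval x = (1 - d) * ((x - β₁) * (x - β₂) * (x - β₃))) ∧
      0 ≤ β₁ ∧ β₁ ≤ β₂ ∧ (0 < cubicDisc d → β₁ < β₂) ∧ β₁ + β₂ < 1 ∧ 2 < β₃ := by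
  obtain ⟨hp1, hp2⟩ := p_bounds hd0 hd
  have hd2 : 0 ≤ d ^ 2 := sq_nonneg d
  have hd3 : 0 ≤ d ^ 3 := by positivity
  have hd2' : d ^ 2 ≤ 433 / 10000 * d := by nlinarith
  have hd3' : d ^ 3 ≤ 433 / 10000 * d := by nlinarith
  have hpd : 0 ≤ p d * d := mul_nonneg (by linarith) hd0
  have hpd' : p d * d ≤ p d := by nlinarith
  have h2 : (cubic d).eval 2 < 0 := by
    rw [eval_cubic, c₀, c₁, c₂, c₃]; nlinarith
  have h3 : 0 < (cubic d).eval (14 / 5) := by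
    rw [eval_cubic, c₀, c₁, c₂, c₃]; nlinarith
  obtain ⟨β₃, ⟨hβl, hβu⟩, hβ⟩ := intermediate_value_Ioo (by norm_num : (2 : ℝ) ≤ 14 / 5)
    (cubic d).continuous.continuousOn ⟨h2, h3⟩
  have hβ : (cubic d).eval β₃ = 0 := hβ
  rw [eval_cubic] at hβ
  have hc3 : 0 < c₃ d := by rw [c₃]; linarith
  have hc0 : c₀ d ≤ 0 := by rw [c₀]; nlinarith [sq_nonneg (1 - d), mul_nonneg hd0 (sq_nonneg (1 - d))]
  -- Division by `X - β₃`: the cubic is `c₃ (X - β₃) (X² + b X + c)`. Since `c₂ / c₃` lies in `[-3,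
  -- -14/5]` and `β₃` in `(2, 14/5)`, it follows that `-1 < b < 0`.
  obtain ⟨b, hb⟩ : ∃ b, b = c₂ d / c₃ d + β₃ := ⟨_, rfl⟩
  obtain ⟨c, hc⟩ : ∃ c, c = c₁ d / c₃ d + β₃ * b := ⟨_, rfl⟩
  have e2 : c₂ d = c₃ d * (b - β₃) := by rw [hb]; field_simp; ring
  have e1 : c₁ d = c₃ d * (c - β₃ * b) := by rw [hc]; field_simp; ring
  have e0 : c₀ d = -(c₃ d * (β₃ * c)) := by
    rw [e1, e2] at hβ; linear_combination hβ
  have hc0' : 0 ≤ c := by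
    have : 0 ≤ (c₃ d * β₃) * c := by linarith
    exact nonneg_of_mul_nonneg_right this (by positivity)
  have hb1 : b < 0 := by
    have : c₂ d / c₃ d ≤ -(14 / 5) := by
      rw [div_le_iff₀ hc3, c₂, c₃]; nlinarith
    linarith
  have hb2 : -1 < b := by
    have : -3 ≤ c₂ d / c₃ d := by
      rw [le_div_iff₀ hc3, c₂, c₃]; nlinarith
    linarith
  -- The discriminant of the cubic is that of the quadratic factor times a positive square, so its
  -- sign is the sign of `b² - 4c`.
  have hdisc' : cubicDisc d = c₃ d ^ 4 * (β₃ ^ 2 + b * β₃ + c) ^ 2 * (b ^ 2 - 4 * c) := by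
    rw [cubicDisc, e0, e1, e2]; ring
  have hQ : 0 < β₃ ^ 2 + b * β₃ + c := by nlinarith
  have hK : 0 < c₃ d ^ 4 * (β₃ ^ 2 + b * β₃ + c) ^ 2 := by positivity
  have hq : 0 ≤ b ^ 2 - 4 * c := by
    rw [hdisc'] at hdisc; exact nonneg_of_mul_nonneg_right hdisc hK
  have hs2 := Real.sq_sqrt hq
  have hs0 := Real.sqrt_nonneg (b ^ 2 - 4 * c)
  set s := Real.sqrt (b ^ 2 - 4 * c) with hs
  have hsb : s ≤ -b := by
    rw [hs]; exact Real.sqrt_le_iff.2 ⟨by linarith, by nlinarith⟩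
  have hfac : cubic d = C (c₃ d) * (({(-b - s) / 2, (-b + s) / 2, β₃} : Multiset ℝ).map
      fun a => X - C a).prod := by
    have hcoef : ∀ x, c₀ d + c₁ d * x + c₂ d * x ^ 2 + c₃ d * x ^ 3 =
        c₃ d * ((x - (-b - s) / 2) * ((x - (-b + s) / 2) * (x - β₃))) := fun x => by
      rw [e0, e1, e2]; linear_combination ((c₃ d * (x - β₃)) / 4) * hs2
    refine Polynomial.funext fun x => ?_
    rw [eval_cubic, hcoef]
    simp
  refine ⟨(-b - s) / 2, (-b + s) / 2, β₃, ?_, fun x => ?_, by linarith, by linarith, fun hpos => ?_,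
    by linarith, hβl⟩
  · rw [hfac, Polynomial.roots_C_mul _ hc3.ne', Polynomial.roots_multiset_prod_X_sub_C]
  · rw [hfac, c₃]
    simp
    ring_nf
    simp
  · have : 0 < s := Real.sqrt_pos.2 (by
      rw [hdisc'] at hpos; exact pos_of_mul_pos_right hpos hK.le)
    linarith

/-- `θ` is the larger root of `X² + p X = q`, and `𝒫(β)` is `(1-δ̄-β)²` times `q - s² - p s` at `s =
β/(1-δ̄-β)`. So `𝒫(β) > 0` puts `s` below `θ`. -/
theorem θ_spec {d β : ℝ} (hd0 : 0 ≤ d) (hd : d < 1) (hβ : 0 < β) (hβd : 0 < 1 - d - β)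
    (hpos : 0 < (cubic d).eval β) :
    0 < θ d β ∧ θ d β ^ 2 + p d * θ d β = q d β ∧ β < θ d β * (1 - d - β) := by
  have hp0 : 0 ≤ p d := by
    have : 0 < 1 - d := by linarith
    rw [p]; positivity
  obtain ⟨s, hs⟩ : ∃ s, s = β / (1 - d - β) := ⟨_, rfl⟩
  have hs0 : 0 < s := by rw [hs]; positivity
  have hsβ : s * (1 - d - β) = β := by rw [hs]; field_simp
  have hid : (cubic d).eval β =
      q d β * (1 - d - β) ^ 2 - β ^ 2 - p d * β * (1 - d - β) := by
    rw [eval_cubic, c₀, c₁, c₂, c₃, q]; ring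
  have hq : s ^ 2 + p d * s < q d β := by
    have h1 : (s ^ 2 + p d * s) * (1 - d - β) ^ 2 = β ^ 2 + p d * β * (1 - d - β) := by
      linear_combination (s * (1 - d - β) + β + p d * (1 - d - β)) * hsβ
    refine lt_of_mul_lt_mul_right ?_ (sq_nonneg (1 - d - β))
    rw [h1]; linarith
  have hsq : 2 * s + p d < Real.sqrt (p d ^ 2 + 4 * q d β) :=
    Real.lt_sqrt_of_sq_lt (by nlinarith)
  have hθs : s < θ d β := by rw [θ]; linarith
  have h2 := Real.sq_sqrt (by nlinarith : 0 ≤ p d ^ 2 + 4 * q d β)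
  refine ⟨hs0.trans hθs, ?_, ?_⟩
  · rw [θ]; linear_combination h2 / 4
  · calc β = s * (1 - d - β) := hsβ.symm
      _ < _ := mul_lt_mul_of_pos_right hθs hβd

/-- The definition of `Δ̄` solves `(β + Δ̄)(1 + θ) = θ (1 - δ̄ - Δ̄)`. The stated inequality follows
because `(1 - δ̄)(1 - Δ̄)` exceeds `1 - δ̄ - Δ̄` by `δ̄ Δ̄ ≥ 0`. -/
theorem Δbar_spec {d β : ℝ} (hd0 : 0 ≤ d) (hβ : 0 < β) (hβd : 0 < 1 - d - β)
    (hθ : 0 < θ d β) (hθβ : β < θ d β * (1 - d - β)) :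
    0 < Δbar d β ∧ Δbar d β < 1 ∧
      (β + Δbar d β) * (1 + θ d β) ≤ θ d β * (1 - d) * (1 - Δbar d β) := by
  have h1 : 0 < 1 + 2 * θ d β := by linarith
  have h0 : 0 < Δbar d β := div_pos (by linarith) h1
  have hmul : Δbar d β * (1 + 2 * θ d β) = θ d β * (1 - d - β) - β := by
    rw [Δbar]; field_simp
  refine ⟨h0, ?_, ?_⟩
  · rw [Δbar, div_lt_one h1]; nlinarith
  · nlinarith [mul_nonneg (mul_nonneg hθ.le hd0) h0.le]

end Scalars

end InexactDual

/-! ### The main theorem -/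

open InexactDual in
theorem mainTheorem2 :
    |δmax - 0.0432863855| ≤ 5 / 10 ^ 11 ∧
    ∀ δb : ℝ, 0 ≤ δb → δb ≤ δmax →
      ∃ β₁ β₂ β₃ : ℝ,
        (cubic δb).roots = {β₁, β₂, β₃} ∧
        0 ≤ β₁ ∧ β₁ ≤ β₂ ∧ (δb < δmax → β₁ < β₂) ∧ β₂ < β₃ ∧
        ∀ β : ℝ, β₁ < β → β < β₂ →
          0 < Δbar δb β ∧
          ∀ (M : ℕ) (n : Fin M → ℕ) (m : ℕ) (P : Problem M n m), P.Standing →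
            ∀ (xb : (Fin m → ℝ) → ℝ → Idx n → ℝ) (y yp : Fin m → ℝ) (t Δt tp : ℝ),
              0 < t → 0 < Δt → Δt < t → tp = t - Δt →
              yp = P.newtonStep xb y tp →
              P.InDom (xb y t) →
              P.err xb yp tp ≤ δb →
              P.err xb y tp ≤ δb →
              localNorm P.bigF (xb y t) (xb y tp - xb y t) ≤ Δbar δb β →
              P.inexDecrement xb y t ≤ β →
              P.inexDecrement xb yp tp ≤ β := by
  obtain ⟨hδ, hdisc⟩ := δmax_spec
  refine ⟨hδ, fun d hd0 hdm => ?_⟩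
  have hd : d ≤ 433 / 10000 := by
    have := (abs_le.1 hδ).2
    norm_num at this
    linarith
  obtain ⟨β₁, β₂, β₃, hroots, heval, h0, h12, hlt, hsum, h3⟩ :=
    cubic_roots hd0 hd (hdisc d hd0 hdm).1
  refine ⟨β₁, β₂, β₃, hroots, h0, h12, fun h => hlt ((hdisc d hd0 hdm).2 h), by linarith,
    fun β hβ1 hβ2 => ?_⟩
  have hd1 : 0 < 1 - d := by linarith
  have hβpos : 0 < (cubic d).eval β := by
    rw [heval]
    have := mul_pos (mul_pos (sub_pos.2 hβ1) (sub_pos.2 hβ2)) (by linarith : 0 < β₃ - β)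
    refine mul_pos hd1 ?_
    linarith
  -- The cubic is negative at `1 - d`. As `β₁ + β₂ < 1` puts `β₁` below `1 - d`, having `1 - d ≤ β₂`
  -- would make the value there nonnegative.
  have hβ₂ : β₂ < 1 - d := by
    have h4 : (cubic d).eval (1 - d) = -(1 - d) ^ 2 := by
      rw [eval_cubic, c₀, c₁, c₂, c₃]; ring
    rw [heval] at h4
    by_contra! hcon
    have h5 := mul_nonneg (mul_nonneg (by linarith : 0 ≤ 1 - d - β₁) (sub_nonneg.2 hcon))
      (by linarith : 0 ≤ β₃ - (1 - d))
    have h6 : 0 < (1 - d) ^ 2 := pow_pos hd1 2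
    nlinarith
  have hβ0 : 0 < β := by linarith
  obtain ⟨hθ, hθq, hθβ⟩ := θ_spec hd0 (by linarith) hβ0 (by linarith) hβpos
  obtain ⟨hΔ0, hΔ1, hΔβ⟩ := Δbar_spec hd0 hβ0 (by linarith) hθ hθβ
  refine ⟨hΔ0, fun M n m P hP xb y yp t Δt tp ht _ hΔt htp hyp hx₀ h₂ h₁ hΔ hβ => ?_⟩
  have key := hP.inexDecrement_newtonStep_le ht (by linarith : 0 < tp) hyp hx₀ hd0 (by linarith)
    hθ.le hΔ1 hΔβ h₂ h₁ hΔ hβ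
  refine le_of_mul_le_mul_right (key.trans_eq ?_) hd1
  rw [q] at hθq
  linear_combination hθq
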